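/- Let $P$ be a configuration of $n \ge 1$ distinct points in the plane $\mathbb{C}$ which is a hull configuration: either all points of $P$ lie on a common line, or no point of $P$ lies in the interior of the convex hull $\mathrm{Conv}(P)$. Let $\mathrm{NC}(P)$ be the set of noncrossing partitions of $P$, i.e. of those set partitions of $P$ for which the convex hulls of the blocks are pairwise disjoint, partially ordered by refinement. A maximal Boolean subposet of $\mathrm{NC}(P)$ is a subset which, with the induced order, is isomorphic to $\mathrm{Bool}(n-1)$, the lattice of all subsets of an $(n-1)$-element set. A noncrossing tree on $P$ is a tree with vertex set $P$ whose edges, drawn as straight line segments, form an embedded graph in $\mathbb{C}$ (no point of $P$ lies in the relative interior of an edge, and distinct edges meet at most in common endpoints). Such a tree $\tau$ has convex geodesics if for every subtree $\sigma \subseteq \tau$ the only points of $P$ in the convex hull of the vertices of $\sigma$ are the vertices of $\sigma$. For a subgraph $\mu$ of $\tau$ with vertex set $P$, let $\mathrm{Part}(\mu)$ be the partition of $P$ into the vertex sets of the connected components of $\mu$, and put $\mathrm{Bool}(\tau) = \{\mathrm{Part}(\mu) : \mu \subseteq \tau\}$. Then $\tau \mapsto \mathrm{Bool}(\tau)$ is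 a bijection from the set of noncrossing trees on $P$ with convex geodesics onto the set of maximal Boolean subposets of $\mathrm{NC}(P)$. Moreover, $\mathrm{NC}(P)$ is the union of its maximal Boolean subposets. -/

import Mathlib

/-- An ordered configuration of `n` distinct points in the plane. -/
abbrev Conf (n : ℕ) : Type := {z : Fin n → ℂ // Function.Injective z}

namespace Conf

variable {n : ℕ}

/-- The convex hull of the points of the configuration `P` whose indices lie in `A`. -/
def hull (P : Conf n) (A : Set (Fin n)) : Set ℂ := convexHull ℝ (P.1 '' A)

/-- `P` is a hull configuration: its points lie on a common line, or none of them lies in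
the interior of the convex hull of `P`. -/
def IsHull (P : Conf n) : Prop :=
  Collinear ℝ (Set.range P.1) ∨ ∀ i, P.1 i ∉ interior (convexHull ℝ (Set.range P.1))

/-- The poset `NC(P)` of noncrossing partitions of `P`, as a subset of the lattice of all set
partitions. A set partition is the setoid whose classes are its blocks, so that `≤` is
refinement; it is noncrossing if the convex hulls of its blocks are pairwise disjoint. -/
def NC (P : Conf n) : Set (Setoid (Fin n)) := {r | r.classes.PairwiseDisjoint P.hull}

/-- A maximal Boolean subposet of `NC(P)`: a subset which, with the induced order, is isomorphic
to the Boolean lattice of all subsets of an `(n - 1)`-element set. -/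
def IsMaximalBoolean (P : Conf n) (B : Set (Setoid (Fin n))) : Prop :=
  B ⊆ P.NC ∧ Nonempty (B ≃o Set (Fin (n - 1)))

/-- The graph `G`, drawn on `P` with straight edges, is embedded in the plane: no vertex lies
inside an edge, and distinct edges do not meet outside of their endpoints. -/
def IsEmbeddedGraph (P : Conf n) (G : SimpleGraph (Fin n)) : Prop :=
  (∀ i j k, G.Adj i j → P.1 k ∉ openSegment ℝ (P.1 i) (P.1 j)) ∧
  ∀ i j k l, G.Adj i j → G.Adj k l → s(i, j) ≠ s(k, l) →
    Disjoint (openSegment ℝ (P.1 i) (P.1 j)) (openSegment ℝ (P.1 k) (P.1 l))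

/-- A noncrossing tree on `P`. -/
def IsNoncrossingTree (P : Conf n) (G : SimpleGraph (Fin n)) : Prop :=
  G.IsTree ∧ P.IsEmbeddedGraph G

/-- The forest `G` on `P` has convex geodesics: for every subtree `T` of `G`, the only points
of `P` in the convex hull of `T` are the vertices of `T`. (A subtree of a forest is
the same as a nonempty connected subgraph.) -/
def HasConvexGeodesics (P : Conf n) (G : SimpleGraph (Fin n)) : Prop :=
  ∀ T : G.Subgraph, T.Connected → ∀ k, P.1 k ∈ P.hull T.verts → k ∈ T.verts

/-- `Bool(G)`: the set of all partitions `Part(μ)` into the vertex sets of the connected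
components of `μ`, where `μ` ranges over the spanning subgraphs of `G`. -/
def boolOfTree (G : SimpleGraph (Fin n)) : Set (Setoid (Fin n)) :=
  {r | ∃ μ : SimpleGraph (Fin n), μ ≤ G ∧ r = μ.reachableSetoid}

end Conf

/-!
A partition of rank `k`, one with `n - k` blocks, is the join of `k` atoms, the partitions whose only
nontrivial block is a pair. A Boolean subposet of rank `n - 1` in the partition lattice of an
`n`-element set consists of partitions of each rank up to `n - 1`, so its bottom is the discrete
partition, and its `n - 1` atoms are the edges of a graph. By induction on the rank, the element which
corresponds to a set of atoms is their join, so it is the partition into the components of the graph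
of these edges; as the top is the partition with one block, the whole graph is a tree
(`Conf.exists_tree_of_orderIso`). Conversely, the partitions of a tree form a Boolean lattice whose atoms are its edges
(`Conf.nonempty_boolOfTree_orderIso`, `Conf.le_of_boolOfTree_subset`). So it remains to see when
`Bool(G)` is in `NC(P)`.

If it is, then two edges without a common vertex are disjoint, being blocks of a noncrossing
partition, and a point in the hull of a subtree is in the block of the subtree
(`Conf.isEmbeddedGraph_of_boolOfTree_subset`, `Conf.hasConvexGeodesics_of_boolOfTree_subset`). Suppose
in turn that the tree is embedded, with convex geodesics, and that the hulls of two components of a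
subforest meet. Neither hull contains a vertex of the other component. If the hull of a connected set
of vertices meets a segment with ends outside of the hull, then an edge between these vertices meets
the segment, since it has to cross the line through it. Used twice, this gives an edge of each
component with a common point, against the embedding (`Conf.boolOfTree_subset_NC`).

For the last claim, a noncrossing partition `r` of a hull configuration has to be in `Bool(τ)` for a
suitable `τ`. The points are in weakly convex position, so they are labelled `0, …, N` along the
boundary of their hull, starting at a corner (`exists_isBoundaryLabelling`). A label is flat if its
point is on the segment between its two neighbors. A tree on the labels, noncrossing for their cyclic
order, has convex geodesics if each flat label separates its neighbors in the tree
(`Conf.hasConvexGeodesics_comap`), since a point in the hull of other points is on a side of the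
polygon between two of them. Such a tree, with each block of `r` connected in it, is constructed by
recursion on intervals of labels (`exists_geodesicTree`). When trees on two intervals are linked by an
edge, its ends are chosen such that labels which become flat separate their neighbors; this choice is
possible since, unless all labels of the interval are on one side, one of its two ends separates its
neighbors in the closed polygon (`HasGeodesicTree`).
-/

/-! ### The rank of a set partition -/

section Rank

variable {n : ℕ}

theorem reachableSetoid_le_iff {G : SimpleGraph (Fin n)} {r : Setoid (Fin n)} :
    G.reachableSetoid ≤ r ↔ ∀ i j, G.Adj i j → r i j := by
  constructor
  · intro h i j hij
    exact h hij.reachable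
  · rintro h i j ⟨w⟩
    induction w with
    | nil => exact r.refl _
    | cons hadj _ ih => exact r.trans (h _ _ hadj) ih

theorem reachableSetoid_mono {G H : SimpleGraph (Fin n)} (h : G ≤ H) :
    G.reachableSetoid ≤ H.reachableSetoid :=
  reachableSetoid_le_iff.2 fun _ _ hij => (h hij).reachable

/-- The number of blocks of a set partition. -/
noncomputable def numBlocks (r : Setoid (Fin n)) : ℕ := Nat.card (Quotient r)

theorem numBlocks_strictAnti : StrictAnti (numBlocks (n := n)) := by
  classical
  intro r s hrs
  let f : Quotient r → Quotient s := Quotient.map id fun a b h => hrs.le h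
  have hsurj : Function.Surjective f := by
    intro q
    induction q using Quotient.inductionOn with
    | h a => exact ⟨Quotient.mk r a, rfl⟩
  have hinj : ¬ Function.Injective f := by
    intro hf
    refine hrs.not_ge fun a b hab => ?_
    exact Quotient.exact (hf (a₁ := Quotient.mk r a) (a₂ := Quotient.mk r b)
      (Quotient.sound (s := s) hab))
  have : Fintype (Quotient r) := Fintype.ofFinite _
  have : Fintype (Quotient s) := Fintype.ofFinite _
  simpa only [numBlocks, Nat.card_eq_fintype_card] using
    Fintype.card_lt_of_surjective_not_injective f hsurj hinj

theorem numBlocks_le (r : Setoid (Fin n)) : numBlocks r ≤ n := by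
  simpa [numBlocks] using Nat.card_le_card_of_surjective (Quotient.mk r) Quotient.mk_surjective

theorem numBlocks_pos (hn : 1 ≤ n) (r : Setoid (Fin n)) : 1 ≤ numBlocks r := by
  have : Nonempty (Quotient r) := ⟨Quotient.mk r ⟨0, hn⟩⟩
  exact Nat.card_pos

/-- A partition of rank one has a single block which is not a singleton, and that block has two
elements. -/
theorem exists_eq_edge_of_numBlocks {r : Setoid (Fin n)} (h : numBlocks r + 1 = n) :
    ∃ i j, i ≠ j ∧ r = (SimpleGraph.edge i j).reachableSetoid := by
  have hbot : r ≠ ⊥ := by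
    rintro rfl
    have : numBlocks (⊥ : Setoid (Fin n)) = n := by
      have := Nat.card_eq_of_bijective (Quotient.mk (⊥ : Setoid (Fin n)))
        ⟨fun a b hab => Quotient.exact hab, Quotient.mk_surjective⟩
      simpa [numBlocks] using this.symm
    omega
  obtain ⟨i, j, hij, hne⟩ : ∃ i j, r i j ∧ i ≠ j := by
    by_contra! hcon
    exact hbot (le_antisymm (fun a b hab => hcon a b hab) bot_le)
  refine ⟨i, j, hne, ?_⟩
  have hadj : (SimpleGraph.edge i j).Adj i j := by simp [SimpleGraph.edge_adj, hne]
  have hle : (SimpleGraph.edge i j).reachableSetoid ≤ r := by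
    refine reachableSetoid_le_iff.2 fun a b hab => ?_
    rw [SimpleGraph.edge_adj] at hab
    rcases hab.1 with ⟨rfl, rfl⟩ | ⟨rfl, rfl⟩
    · exact hij
    · exact r.symm hij
  have hpos : (⊥ : Setoid (Fin n)) < (SimpleGraph.edge i j).reachableSetoid := by
    refine lt_of_le_of_ne bot_le fun hb => hne ?_
    have : (⊥ : Setoid (Fin n)) i j := by
      rw [hb]; exact hadj.reachable
    exact this
  have h1 := numBlocks_strictAnti hpos
  have h2 := numBlocks_le (⊥ : Setoid (Fin n))
  refine (eq_of_le_of_not_lt hle fun hlt => ?_).symm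
  have h3 := numBlocks_strictAnti hlt
  omega

/-- A strictly antitone function on the subsets of an `m`-element set, with values in an interval
of `m + 1` integers, is the corank function. -/
theorem StrictAnti.add_ncard_eq {m : ℕ} {φ : Set (Fin m) → ℕ} (hφ : StrictAnti φ)
    (h0 : φ ∅ ≤ m + 1) (h1 : 1 ≤ φ Set.univ) (S : Set (Fin m)) : φ S + S.ncard = m + 1 := by
  have hup : ∀ T : Set (Fin m), φ T + T.ncard ≤ m + 1 := by
    intro T
    induction T, T.toFinite using Set.Finite.induction_on with
    | empty => simpa using h0
    | @insert x T hx hT ih =>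
      have := hφ (Set.ssubset_insert hx)
      rw [Set.ncard_insert_of_notMem hx hT]
      omega
  have hdown : ∀ T : Set (Fin m), 1 + T.ncard ≤ φ Tᶜ := by
    intro T
    induction T, T.toFinite using Set.Finite.induction_on with
    | empty => simpa using h1
    | @insert x T hx hT ih =>
      have := hφ (compl_lt_compl_iff_lt.2 (Set.ssubset_insert hx))
      rw [Set.ncard_insert_of_notMem hx hT]
      omega
  have h2 := hup S
  have h3 := hdown Sᶜ
  have h4 := Set.ncard_add_ncard_compl S
  rw [compl_compl] at h3
  rw [Nat.card_eq_fintype_card, Fintype.card_fin] at h4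
  omega

end Rank

/-! ### Boolean subposets and trees -/

namespace Conf

variable {n : ℕ}

/-- Distinct subgraphs of a forest have distinct partitions into components, and the partitions
are ordered as the subgraphs. -/
theorem le_of_reachableSetoid_le {G μ ν : SimpleGraph (Fin n)} (hG : G.IsAcyclic) (hμ : μ ≤ G)
    (hν : ν ≤ G) (h : μ.reachableSetoid ≤ ν.reachableSetoid) : μ ≤ ν := by
  intro i j hij
  by_contra hnot
  have hb := SimpleGraph.isAcyclic_iff_forall_adj_isBridge.1 hG (hμ hij)
  rw [SimpleGraph.isBridge_iff] at hb
  refine hb ((h hij.reachable : ν.Reachable i j).mono fun a b hab => ?_)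
  rw [SimpleGraph.deleteEdges_adj]
  refine ⟨hν hab, fun hmem => hnot ?_⟩
  rw [Set.mem_singleton_iff, Sym2.eq_iff] at hmem
  rcases hmem with ⟨rfl, rfl⟩ | ⟨rfl, rfl⟩
  · exact hab
  · exact hab.symm

/-- The partitions of a tree `G` form a Boolean lattice: that of the subsets of its `n - 1`
edges. -/
theorem nonempty_boolOfTree_orderIso {G : SimpleGraph (Fin n)} (hG : G.IsTree) :
    Nonempty (boolOfTree G ≃o Set (Fin (n - 1))) := by
  classical
  have hcard : Nat.card G.edgeSet = n - 1 := by
    have := hG.card_edgeFinset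
    rw [Fintype.card_fin] at this
    rw [Nat.card_eq_fintype_card, ← SimpleGraph.edgeFinset_card]
    omega
  have e : G.edgeSet ≃ Fin (n - 1) := Finite.equivFinOfCardEq hcard
  let g : Set (Fin (n - 1)) → SimpleGraph (Fin n) := fun S =>
    SimpleGraph.fromEdgeSet ((fun x => ((e.symm x : G.edgeSet) : Sym2 (Fin n))) '' S)
  have hadj : ∀ (S) (i j) (h : G.Adj i j), (g S).Adj i j ↔ e ⟨s(i, j), h⟩ ∈ S := by
    intro S i j h
    rw [SimpleGraph.fromEdgeSet_adj]
    constructor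
    · rintro ⟨⟨x, hx, hxe⟩, -⟩
      have : e.symm x = ⟨s(i, j), h⟩ := Subtype.ext hxe
      rwa [← this, Equiv.apply_symm_apply]
    · intro hx
      exact ⟨⟨_, hx, by simp⟩, h.ne⟩
  have hg : ∀ S, g S ≤ G := by
    intro S i j hij
    rw [SimpleGraph.fromEdgeSet_adj] at hij
    obtain ⟨⟨x, -, hx⟩, -⟩ := hij
    rw [← SimpleGraph.mem_edgeSet, ← hx]
    exact (e.symm x).2
  let f : Set (Fin (n - 1)) → boolOfTree G := fun S => ⟨(g S).reachableSetoid, g S, hg S, rfl⟩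
  have hf : ∀ S T, f S ≤ f T ↔ S ⊆ T := by
    intro S T
    constructor
    · intro h x hx
      have hle : g S ≤ g T := le_of_reachableSetoid_le hG.isAcyclic (hg S) (hg T) h
      obtain ⟨y, rfl⟩ := e.surjective x
      obtain ⟨y, hy⟩ := y
      induction y using Sym2.ind with
      | h i j => exact (hadj T i j hy).1 (hle ((hadj S i j hy).2 hx))
    · intro h
      refine reachableSetoid_mono fun i j hij => ?_
      exact (hadj T i j (hg S hij)).2 (h ((hadj S i j (hg S hij)).1 hij))
  have hsurj : Function.Surjective f := by
    rintro ⟨r, μ, hμ, rfl⟩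
    refine ⟨{x | ((e.symm x : G.edgeSet) : Sym2 (Fin n)) ∈ μ.edgeSet}, Subtype.ext ?_⟩
    suffices h : g {x | ((e.symm x : G.edgeSet) : Sym2 (Fin n)) ∈ μ.edgeSet} = μ by
      change (g _).reachableSetoid = _
      rw [h]
    ext i j
    by_cases hij : G.Adj i j
    · rw [hadj _ i j hij]
      simp
    · exact ⟨fun h => (hij (hg _ h)).elim, fun h => (hij (hμ h)).elim⟩
  let F : Set (Fin (n - 1)) ↪o boolOfTree G := OrderEmbedding.ofMapLEIff f hf
  exact ⟨(OrderIso.ofSurjective F hsurj).symm⟩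

/-- The edges of a graph are the two-element blocks of the atoms of its Boolean poset. -/
theorem le_of_boolOfTree_subset {G H : SimpleGraph (Fin n)} (h : boolOfTree G ⊆ boolOfTree H) :
    G ≤ H := by
  intro i j hij
  have hle : SimpleGraph.edge i j ≤ G := by
    intro a b hab
    rw [SimpleGraph.edge_adj] at hab
    rcases hab.1 with ⟨rfl, rfl⟩ | ⟨rfl, rfl⟩
    · exact hij
    · exact hij.symm
  obtain ⟨ν, hν, hr⟩ := h ⟨_, hle, rfl⟩
  have hreach : ν.Reachable i j := by
    have : (SimpleGraph.edge i j).reachableSetoid i j :=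
      SimpleGraph.Adj.reachable (by simp [SimpleGraph.edge_adj, hij.ne])
    rw [hr] at this
    exact this
  obtain ⟨w⟩ := hreach
  cases w with
  | nil => exact (hij.ne rfl).elim
  | @cons _ k _ hik _ =>
    have h1 : (SimpleGraph.edge i j).Reachable i k := by
      have : ν.reachableSetoid i k := hik.reachable
      rw [← hr] at this
      exact this
    have h2 : ∀ x, (SimpleGraph.edge i j).Reachable i x → x = i ∨ x = j := by
      rintro x ⟨w⟩
      have : ∀ (a b) (w : (SimpleGraph.edge i j).Walk a b), (a = i ∨ a = j) → (b = i ∨ b = j) := by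
        intro a b w
        induction w with
        | nil => exact id
        | cons hadj _ ih =>
          intro _
          rw [SimpleGraph.edge_adj] at hadj
          exact ih (by tauto)
      exact this _ _ w (Or.inl rfl)
    rcases h2 k h1 with rfl | rfl
    · exact (hik.ne rfl).elim
    · exact hν hik

/-- Every subset of the partition lattice which is isomorphic to the Boolean lattice of rank
`n - 1` comes from a tree. A maximal chain of such a subset is as long as one of the partition
lattice, so the isomorphism matches the rank functions. The atoms thus are edges, and induction on
the rank shows that each element is the join of the atoms below it. -/
theorem exists_tree_of_orderIso (hn : 1 ≤ n) {B : Set (Setoid (Fin n))}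
    (e : B ≃o Set (Fin (n - 1))) : ∃ G : SimpleGraph (Fin n), G.IsTree ∧ boolOfTree G = B := by
  classical
  let r : Set (Fin (n - 1)) → Setoid (Fin n) := fun S => (e.symm S).1
  have hr : ∀ S T, r S ≤ r T ↔ S ⊆ T := fun S T => e.symm.le_iff_le
  have hrs : StrictMono r := fun S T hST =>
    lt_of_le_not_ge ((hr S T).2 hST.1) fun h => hST.2 ((hr T S).1 h)
  have hrank : ∀ S, numBlocks (r S) + S.ncard = n := by
    intro S
    have := StrictAnti.add_ncard_eq (φ := fun S => numBlocks (r S))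
      (numBlocks_strictAnti.comp_strictMono hrs) (by have := numBlocks_le (r ∅); omega)
      (numBlocks_pos hn _) S
    omega
  have hatom : ∀ x, ∃ i j, i ≠ j ∧ r {x} = (SimpleGraph.edge i j).reachableSetoid := by
    intro x
    refine exists_eq_edge_of_numBlocks ?_
    simpa using hrank {x}
  choose i j hne hatom using hatom
  let g : Set (Fin (n - 1)) → SimpleGraph (Fin n) := fun S =>
    SimpleGraph.fromEdgeSet ((fun x => s(i x, j x)) '' S)
  have hgadj : ∀ S x, x ∈ S → (g S).Adj (i x) (j x) := by
    intro S x hx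
    rw [SimpleGraph.fromEdgeSet_adj]
    exact ⟨⟨x, hx, rfl⟩, hne x⟩
  have hgmono : ∀ S T, S ⊆ T → g S ≤ g T := fun S T h =>
    SimpleGraph.fromEdgeSet_mono (Set.image_mono h)
  have hrij : ∀ x, r {x} (i x) (j x) := by
    intro x
    rw [hatom]
    exact SimpleGraph.Adj.reachable (by simp [SimpleGraph.edge_adj, hne])
  have hle : ∀ S, (g S).reachableSetoid ≤ r S := by
    intro S
    refine reachableSetoid_le_iff.2 fun a b hab => ?_
    rw [SimpleGraph.fromEdgeSet_adj] at hab
    obtain ⟨⟨x, hx, hxe⟩, -⟩ := hab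
    have h1 : r S (i x) (j x) := (hr {x} S).2 (by simpa using hx) (hrij x)
    rcases Sym2.eq_iff.1 hxe with ⟨rfl, rfl⟩ | ⟨rfl, rfl⟩
    · exact h1
    · exact (r S).symm h1
  have hge : ∀ S x, x ∈ S → r {x} ≤ (g S).reachableSetoid := by
    intro S x hx
    rw [hatom, reachableSetoid_le_iff]
    intro a b hab
    rw [SimpleGraph.edge_adj] at hab
    rcases hab.1 with ⟨rfl, rfl⟩ | ⟨rfl, rfl⟩
    · exact (hgadj S x hx).reachable
    · exact (hgadj S x hx).symm.reachable
  have heq : ∀ S, (g S).reachableSetoid = r S := by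
    intro S
    induction S, S.toFinite using Set.Finite.induction_on with
    | empty =>
      have h1 := hrank ∅
      rw [Set.ncard_empty] at h1
      refine eq_of_le_of_not_lt (hle ∅) fun hlt => ?_
      have := numBlocks_strictAnti hlt
      have := numBlocks_le (g ∅).reachableSetoid
      omega
    | @insert x S hx hS ih =>
      -- The join is strictly above `r S`, hence has the rank of `r (insert x S)`.
      have h1 : r S < (g (insert x S)).reachableSetoid := by
        refine lt_of_le_not_ge (ih ▸ reachableSetoid_mono (hgmono _ _ (Set.subset_insert x S)))
          fun hcon => hx ?_
        have := (hr {x} S).1 ((hge _ x (Set.mem_insert x S)).trans hcon)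
        simpa using this
      refine eq_of_le_of_not_lt (hle _) fun hlt => ?_
      have h2 := numBlocks_strictAnti h1
      have h3 := numBlocks_strictAnti hlt
      have h4 := hrank S
      have h5 := hrank (insert x S)
      rw [Set.ncard_insert_of_notMem hx hS] at h5
      omega
  have : Nonempty (Fin n) := ⟨⟨0, hn⟩⟩
  have hconn : (g Set.univ).Connected := by
    refine ⟨fun a b => ?_⟩
    have h1 := hrank Set.univ
    rw [Set.ncard_univ, Nat.card_eq_fintype_card, Fintype.card_fin] at h1
    have h2 : numBlocks (r Set.univ) = 1 := by omega
    have h3 : Subsingleton (Quotient (r Set.univ)) := (Nat.card_eq_one_iff_unique.1 h2).1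
    have h4 : r Set.univ a b := Quotient.exact (Subsingleton.elim _ _)
    rw [← heq] at h4
    exact h4
  refine ⟨g Set.univ, ?_, ?_⟩
  · rw [SimpleGraph.isTree_iff_connected_and_card]
    refine ⟨hconn, ?_⟩
    have h1 := hconn.card_vert_le_card_edgeSet_add_one
    have h2 : Nat.card (g Set.univ).edgeSet ≤ n - 1 := by
      have h3 : (g Set.univ).edgeSet ⊆ Set.range fun x => s(i x, j x) := by
        rw [SimpleGraph.edgeSet_fromEdgeSet, Set.image_univ]
        exact Set.sdiff_subset
      have h4 := Set.ncard_le_ncard h3 (Set.toFinite _)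
      rw [← Set.image_univ] at h4
      have h5 := Set.ncard_image_le (f := fun x => s(i x, j x)) (Set.toFinite Set.univ)
      rw [Set.ncard_univ, Nat.card_eq_fintype_card, Fintype.card_fin] at h5
      rw [Nat.card_coe_set_eq]
      omega
    rw [Nat.card_eq_fintype_card (α := Fin n), Fintype.card_fin] at h1 ⊢
    omega
  · ext s
    constructor
    · rintro ⟨μ, hμ, rfl⟩
      have : μ = g {x | μ.Adj (i x) (j x)} := by
        ext a b
        rw [SimpleGraph.fromEdgeSet_adj]
        constructor
        · intro hab
          have h1 := hμ hab
          rw [SimpleGraph.fromEdgeSet_adj] at h1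
          obtain ⟨⟨x, -, hx⟩, hab'⟩ := h1
          refine ⟨⟨x, ?_, hx⟩, hab'⟩
          rcases Sym2.eq_iff.1 hx with ⟨rfl, rfl⟩ | ⟨rfl, rfl⟩
          · exact hab
          · exact hab.symm
        · rintro ⟨⟨x, hx, hxe⟩, -⟩
          rcases Sym2.eq_iff.1 hxe with ⟨rfl, rfl⟩ | ⟨rfl, rfl⟩
          · exact hx
          · exact SimpleGraph.Adj.symm hx
      rw [this, heq]
      exact (e.symm _).2
    · intro hs
      refine ⟨g (e ⟨s, hs⟩), hgmono _ _ (Set.subset_univ _), ?_⟩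
      rw [heq]
      simp [r]

/-! ### From Boolean subposets to noncrossing trees -/

variable {P : Conf n}

theorem disjoint_hull_of_mem_NC {r : Setoid (Fin n)} (hr : r ∈ P.NC) {i j : Fin n}
    (hij : ¬ r i j) : Disjoint (P.hull {k | r k i}) (P.hull {k | r k j}) := by
  refine hr (Setoid.mem_classes r i) (Setoid.mem_classes r j) fun h => hij ?_
  have : i ∈ {k | r k i} := r.refl i
  rw [h] at this
  exact this

theorem mem_hull {A : Set (Fin n)} {i : Fin n} (h : i ∈ A) : P.1 i ∈ P.hull A :=
  subset_convexHull ℝ _ (Set.mem_image_of_mem _ h)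

theorem hull_mono {A B : Set (Fin n)} (h : A ⊆ B) : P.hull A ⊆ P.hull B :=
  convexHull_mono (Set.image_mono h)

theorem segment_subset_hull {A : Set (Fin n)} {i j : Fin n} (hi : i ∈ A) (hj : j ∈ A) :
    segment ℝ (P.1 i) (P.1 j) ⊆ P.hull A :=
  (convex_convexHull ℝ _).segment_subset (mem_hull hi) (mem_hull hj)

theorem hasConvexGeodesics_of_boolOfTree_subset {G : SimpleGraph (Fin n)}
    (h : boolOfTree G ⊆ P.NC) : P.HasConvexGeodesics G := by
  intro T hT k hk
  by_contra hkT
  obtain ⟨v, hv⟩ := hT.nonempty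
  let μ : SimpleGraph (Fin n) := T.spanningCoe
  have hμ : μ ∈ {μ | μ ≤ G} := T.spanningCoe_le
  have hout : ∀ x, μ.Reachable x v → x ∈ T.verts := by
    rintro x ⟨w⟩
    cases w with
    | nil => exact hv
    | cons hadj _ => exact T.edge_vert hadj
  have hin : T.verts ⊆ {x | μ.reachableSetoid x v} := by
    intro x hx
    obtain ⟨w⟩ := hT.preconnected ⟨x, hx⟩ ⟨v, hv⟩
    exact ⟨w.map ⟨Subtype.val, fun h => h⟩⟩
  have hd := disjoint_hull_of_mem_NC (h ⟨μ, hμ, rfl⟩) (i := k) (j := v) fun hr => hkT (hout k hr)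
  exact Set.disjoint_left.1 hd (mem_hull (μ.reachableSetoid.refl k)) (hull_mono hin hk)

/-- No vertex lies inside an edge, as an edge is a subtree. -/
theorem HasConvexGeodesics.notMem_openSegment {G : SimpleGraph (Fin n)}
    (h : P.HasConvexGeodesics G) {i j : Fin n} (hij : G.Adj i j) (k : Fin n) :
    P.1 k ∉ openSegment ℝ (P.1 i) (P.1 j) := by
  intro hk
  have h1 := h (G.subgraphOfAdj hij) (SimpleGraph.Subgraph.subgraphOfAdj_connected hij) k
    (segment_subset_hull (by simp) (by simp) (openSegment_subset_segment _ _ _ hk))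
  have hne : P.1 i ≠ P.1 j := fun h => hij.ne (P.2 h)
  simp only [SimpleGraph.subgraphOfAdj_verts, Set.mem_insert_iff, Set.mem_singleton_iff] at h1
  rcases h1 with rfl | rfl
  · exact hne (left_mem_openSegment_iff.1 hk)
  · exact hne (right_mem_openSegment_iff.1 hk)

end Conf

namespace Conf

variable {n : ℕ} {P : Conf n}

/-- Two open segments which start at the same point and meet are nested. -/
theorem mem_openSegment_or_of_common_left {p q r x : ℂ} (hqr : q ≠ r)
    (hq : x ∈ openSegment ℝ p q) (hr : x ∈ openSegment ℝ p r) :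
    q ∈ openSegment ℝ p r ∨ r ∈ openSegment ℝ p q := by
  wlog! H : ∃ s t : ℝ, 0 < s ∧ s < t ∧ t < 1 ∧ p + t • (q - p) = x ∧ p + s • (r - p) = x
    generalizing q r
  · rw [openSegment_eq_image'] at hq hr
    obtain ⟨t, ht, htx⟩ := hq
    obtain ⟨s, hs, hsx⟩ := hr
    rcases lt_trichotomy s t with hst | rfl | hst
    · exact absurd hsx (H s t hs.1 hst ht.2 htx)
    · refine (hqr ?_).elim
      have h1 : s • (q - p) = s • (r - p) := add_left_cancel (htx.trans hsx.symm)
      simpa using smul_right_injective ℂ hs.1.ne' h1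
    · refine (this hqr.symm ?_ ?_ ⟨t, s, ht.1, hst, hs.2, hsx, htx⟩).symm
      · rw [openSegment_eq_image']; exact ⟨s, hs, hsx⟩
      · rw [openSegment_eq_image']; exact ⟨t, ht, htx⟩
  obtain ⟨s, t, hs, hst, -, htx, hsx⟩ := H
  left
  rw [openSegment_eq_image']
  have ht : 0 < t := hs.trans hst
  refine ⟨s / t, ⟨by positivity, (div_lt_one ht).2 hst⟩, ?_⟩
  have h1 : t • (q - p) = s • (r - p) := add_left_cancel (htx.trans hsx.symm)
  change p + (s / t) • (r - p) = q
  rw [div_eq_inv_mul, mul_smul, ← h1, smul_smul, inv_mul_cancel₀ ht.ne', one_smul]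
  ring

/-- Two edges with a common endpoint do not meet elsewhere, since otherwise one of them would
contain an endpoint of the other. -/
theorem HasConvexGeodesics.disjoint_of_common_left {G : SimpleGraph (Fin n)}
    (h : P.HasConvexGeodesics G) {i j k : Fin n} (hij : G.Adj i j) (hik : G.Adj i k)
    (hjk : j ≠ k) :
    Disjoint (openSegment ℝ (P.1 i) (P.1 j)) (openSegment ℝ (P.1 i) (P.1 k)) := by
  rw [Set.disjoint_left]
  intro x hx hx'
  rcases mem_openSegment_or_of_common_left (fun h => hjk (P.2 h)) hx hx' with h1 | h1
  · exact h.notMem_openSegment hik j h1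
  · exact h.notMem_openSegment hij k h1

theorem HasConvexGeodesics.isEmbeddedGraph {G : SimpleGraph (Fin n)}
    (hcg : P.HasConvexGeodesics G)
    (h : ∀ i j k l, G.Adj i j → G.Adj k l → i ≠ k → i ≠ l → j ≠ k → j ≠ l →
      Disjoint (openSegment ℝ (P.1 i) (P.1 j)) (openSegment ℝ (P.1 k) (P.1 l))) :
    P.IsEmbeddedGraph G := by
  refine ⟨fun i j k hij => hcg.notMem_openSegment hij k, ?_⟩
  intro i j k l hij hkl hne
  by_cases hik : i = k
  · subst hik
    exact hcg.disjoint_of_common_left hij hkl fun h => hne (by rw [h])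
  by_cases hil : i = l
  · subst hil
    rw [openSegment_symm ℝ (P.1 k)]
    exact hcg.disjoint_of_common_left hij hkl.symm fun h => hne (by rw [h, Sym2.eq_swap])
  by_cases hjk : j = k
  · subst hjk
    rw [openSegment_symm ℝ (P.1 i)]
    exact hcg.disjoint_of_common_left hij.symm hkl hil
  by_cases hjl : j = l
  · subst hjl
    rw [openSegment_symm ℝ (P.1 i), openSegment_symm ℝ (P.1 k)]
    exact hcg.disjoint_of_common_left hij.symm hkl.symm hik
  exact h i j k l hij hkl hik hil hjk hjl

theorem isEmbeddedGraph_of_boolOfTree_subset {G : SimpleGraph (Fin n)}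
    (h : boolOfTree G ⊆ P.NC) : P.IsEmbeddedGraph G := by
  refine (hasConvexGeodesics_of_boolOfTree_subset h).isEmbeddedGraph ?_
  intro i j k l hij hkl hik hil hjk hjl
  let μ := SimpleGraph.edge i j ⊔ SimpleGraph.edge k l
  have hμ : μ ≤ G := by
    intro a b hab
    rw [SimpleGraph.sup_adj, SimpleGraph.edge_adj, SimpleGraph.edge_adj] at hab
    rcases hab with ⟨⟨rfl, rfl⟩ | ⟨rfl, rfl⟩, -⟩ | ⟨⟨rfl, rfl⟩ | ⟨rfl, rfl⟩, -⟩
    exacts [hij, hij.symm, hkl, hkl.symm]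
  have hnr : ¬ μ.reachableSetoid i k := by
    rintro ⟨w⟩
    have : ∀ (a b) (w : μ.Walk a b), (a = i ∨ a = j) → (b = i ∨ b = j) := by
      intro a b w
      induction w with
      | nil => exact id
      | cons hadj _ ih =>
        intro ha
        rw [SimpleGraph.sup_adj, SimpleGraph.edge_adj, SimpleGraph.edge_adj] at hadj
        refine ih ?_
        rcases hadj with ⟨⟨rfl, rfl⟩ | ⟨rfl, rfl⟩, -⟩ | ⟨⟨rfl, rfl⟩ | ⟨rfl, rfl⟩, -⟩
        · exact Or.inr rfl
        · exact Or.inl rfl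
        · rcases ha with h | h
          · exact (hik h.symm).elim
          · exact (hjk h.symm).elim
        · rcases ha with h | h
          · exact (hil h.symm).elim
          · exact (hjl h.symm).elim
    rcases this _ _ w (Or.inl rfl) with h | h
    · exact hik h.symm
    · exact hjk h.symm
  refine (disjoint_hull_of_mem_NC (h ⟨μ, hμ, rfl⟩) hnr).mono ?_ ?_
  · refine (openSegment_subset_segment ℝ _ _).trans (segment_subset_hull (μ.reachableSetoid.refl i)
      (SimpleGraph.Adj.reachable ?_))
    simp [μ, SimpleGraph.edge_adj, hij.ne.symm]
  · refine (openSegment_subset_segment ℝ _ _).trans (segment_subset_hull (μ.reachableSetoid.refl k)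
      (SimpleGraph.Adj.reachable ?_))
    simp [μ, SimpleGraph.edge_adj, hkl.ne.symm]

/-! ### Partitions of noncrossing trees with convex geodesics are noncrossing -/

/-- The linear functional `w ↦ det (u, w)`, whose level sets are the lines in the direction
of `u`. -/
noncomputable def crossForm (u : ℂ) : ℂ →ₗ[ℝ] ℝ := u.re • Complex.imLm - u.im • Complex.reLm

theorem crossForm_apply (u w : ℂ) : crossForm u w = u.re * w.im - u.im * w.re := by
  simp [crossForm]

theorem exists_smul_of_crossForm_eq_zero {u v : ℂ} (hu : u ≠ 0) (h : crossForm u v = 0) :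
    ∃ s : ℝ, v = s • u := by
  rw [crossForm_apply] at h
  have hpos : u.re * u.re + u.im * u.im ≠ 0 := by
    have := Complex.normSq_pos.2 hu
    rw [Complex.normSq_apply] at this
    exact this.ne'
  refine ⟨(u.re * v.re + u.im * v.im) / (u.re * u.re + u.im * u.im), ?_⟩
  apply Complex.ext
  · simp only [Complex.real_smul, Complex.re_ofReal_mul]
    rw [div_mul_eq_mul_div, eq_div_iff hpos]
    linear_combination -u.im * h
  · simp only [Complex.real_smul, Complex.im_ofReal_mul]
    rw [div_mul_eq_mul_div, eq_div_iff hpos]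
    linear_combination u.re * h

/-- A convex set which meets a segment at `x`, but contains neither of its endpoints, meets the
line through the segment in points of the segment only. -/
theorem mem_segment_of_mem_line {K : Set ℂ} (hK : Convex ℝ K) {y₁ y₂ x x' : ℂ} (h₁ : y₁ ∉ K)
    (h₂ : y₂ ∉ K) (hx : x ∈ K) (hxy : x ∈ segment ℝ y₁ y₂) (hx' : x' ∈ K)
    (hline : crossForm (y₂ - y₁) x' = crossForm (y₂ - y₁) y₁) : x' ∈ segment ℝ y₁ y₂ := by
  have hne : y₂ - y₁ ≠ 0 := by
    intro h0
    have h0 : y₂ = y₁ := sub_eq_zero.1 h0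
    rw [h0, segment_same, Set.mem_singleton_iff] at hxy
    exact h₁ (hxy ▸ hx)
  obtain ⟨s, hs⟩ := exists_smul_of_crossForm_eq_zero (v := x' - y₁) hne
    (by rw [map_sub, hline, sub_self])
  rw [segment_eq_image'] at hxy ⊢
  obtain ⟨t, ⟨ht0, ht1⟩, rfl⟩ := hxy
  obtain rfl : x' = y₁ + s • (y₂ - y₁) := by rw [← hs]; ring
  refine ⟨s, ⟨?_, ?_⟩, rfl⟩
  · by_contra! hs0
    have hts : 0 < t - s := by linarith
    refine h₁ ?_
    convert hK hx' hx (div_nonneg ht0 hts.le) (div_nonneg (neg_nonneg.2 hs0.le) hts.le)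
      (by field_simp; ring) using 1
    simp only [smul_add, smul_smul]
    match_scalars <;> field_simp <;> ring
  · by_contra! hs1
    have hst : 0 < s - t := by linarith
    refine h₂ ?_
    convert hK hx' hx (div_nonneg (sub_nonneg.2 ht1) hst.le)
      (div_nonneg (sub_nonneg.2 hs1.le) hst.le) (by field_simp; ring) using 1
    simp only [smul_add, smul_smul]
    match_scalars <;> field_simp <;> ring

theorem exists_mem_segment_eq_zero {a b : ℂ} (φ : ℂ →ₗ[ℝ] ℝ) {c : ℝ} (ha : φ a ≤ c)
    (hb : c ≤ φ b) : ∃ x ∈ segment ℝ a b, φ x = c := by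
  have h1 : c ∈ segment ℝ (φ a) (φ b) := by
    rw [segment_eq_Icc (ha.trans hb)]; exact ⟨ha, hb⟩
  have h2 := image_segment ℝ φ.toAffineMap a b
  simp only [LinearMap.coe_toAffineMap] at h2
  rw [← h2] at h1
  obtain ⟨x, hx, rfl⟩ := h1
  exact ⟨x, hx, rfl⟩

/-- If a segment with endpoints outside of the convex hull of a connected set `X` of vertices meets
this hull, then it meets an edge of `X`, or a vertex: the vertices of `X` are not all on the same
side of the line through the segment, so an edge of `X` meets this line. -/
theorem exists_edge_inter_segment {μ : SimpleGraph (Fin n)} {i : Fin n} {y₁ y₂ x : ℂ}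
    (h₁ : y₁ ∉ P.hull {k | μ.reachableSetoid k i}) (h₂ : y₂ ∉ P.hull {k | μ.reachableSetoid k i})
    (hx : x ∈ P.hull {k | μ.reachableSetoid k i}) (hxy : x ∈ segment ℝ y₁ y₂) :
    ∃ a b, (a = b ∨ μ.Adj a b) ∧ μ.reachableSetoid a i ∧ μ.reachableSetoid b i ∧
      (segment ℝ (P.1 a) (P.1 b) ∩ segment ℝ y₁ y₂).Nonempty := by
  set X := {k | μ.reachableSetoid k i}
  set φ := crossForm (y₂ - y₁) with hφ
  have hφx : φ x = φ y₁ := by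
    rw [segment_eq_image'] at hxy
    obtain ⟨t, -, rfl⟩ := hxy
    have : φ (y₂ - y₁) = 0 := by rw [hφ, crossForm_apply]; ring
    change φ (y₁ + t • (y₂ - y₁)) = φ y₁
    rw [map_add, map_smul, this, smul_zero, add_zero]
  obtain ⟨a, ha, hφa⟩ : ∃ a ∈ X, φ (P.1 a) ≤ φ y₁ := by
    by_contra! hcon
    have := convexHull_min (t := {w | φ y₁ < φ w}) (by rintro _ ⟨k, hk, rfl⟩; exact hcon k hk)
      (convex_halfSpace_gt φ.isLinear _) hx
    exact (this : φ y₁ < φ x).ne' hφx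
  obtain ⟨b, hb, hφb⟩ : ∃ b ∈ X, φ y₁ ≤ φ (P.1 b) := by
    by_contra! hcon
    have := convexHull_min (t := {w | φ w < φ y₁}) (by rintro _ ⟨k, hk, rfl⟩; exact hcon k hk)
      (convex_halfSpace_lt φ.isLinear _) hx
    exact (this : φ x < φ y₁).ne hφx
  obtain ⟨w⟩ : μ.Reachable a b := μ.reachableSetoid.trans ha (μ.reachableSetoid.symm hb)
  have key : ∀ (a b) (w : μ.Walk a b), μ.reachableSetoid a i → φ (P.1 a) ≤ φ y₁ →
      φ y₁ ≤ φ (P.1 b) → ∃ a b, (a = b ∨ μ.Adj a b) ∧ μ.reachableSetoid a i ∧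
        μ.reachableSetoid b i ∧ φ (P.1 a) ≤ φ y₁ ∧ φ y₁ ≤ φ (P.1 b) := by
    intro a b w
    induction w with
    | nil => exact fun ha h h' => ⟨_, _, Or.inl rfl, ha, ha, h, h'⟩
    | @cons u v _ hadj _ ih =>
      intro ha h h'
      have hv : μ.reachableSetoid v i := μ.reachableSetoid.trans hadj.symm.reachable ha
      by_cases hc : φ y₁ ≤ φ (P.1 v)
      · exact ⟨u, v, Or.inr hadj, ha, hv, h, hc⟩
      · exact ih hv (le_of_not_ge hc) h'
  obtain ⟨a', b', hab, ha', hb', hφa', hφb'⟩ := key a b w ha hφa hφb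
  obtain ⟨x', hx', hφx'⟩ := exists_mem_segment_eq_zero φ hφa' hφb'
  exact ⟨a', b', hab, ha', hb', x', hx', mem_segment_of_mem_line (convex_convexHull ℝ _) h₁ h₂ hx
    hxy (segment_subset_hull ha' hb' hx') hφx'⟩

/-- If the convex hull of a connected set `X` of vertices meets that of a set `Y` of points outside
of it, then an edge of `X`, or a vertex, meets the convex hull of `Y`. -/
theorem exists_edge_inter_hull {μ : SimpleGraph (Fin n)} {i : Fin n} (Y : Set (Fin n))
    (hY : ∀ k ∈ Y, P.1 k ∉ P.hull {k | μ.reachableSetoid k i})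
    (hne : (P.hull {k | μ.reachableSetoid k i} ∩ P.hull Y).Nonempty) :
    ∃ a b, (a = b ∨ μ.Adj a b) ∧ μ.reachableSetoid a i ∧ μ.reachableSetoid b i ∧
      (segment ℝ (P.1 a) (P.1 b) ∩ P.hull Y).Nonempty := by
  induction Y, Y.toFinite using Set.Finite.induction_on with
  | empty =>
    obtain ⟨x, -, hx⟩ := hne
    simp [hull] at hx
  | @insert k Y hk hYf ih =>
    obtain ⟨x, hx, hxY⟩ := hne
    have hk' := hY k (Set.mem_insert k Y)
    rcases Y.eq_empty_or_nonempty with rfl | hYne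
    · simp only [hull, insert_empty_eq, Set.image_singleton, convexHull_singleton,
        Set.mem_singleton_iff] at hxY
      exact (hk' (hxY ▸ hx)).elim
    · rw [hull, Set.image_insert_eq, convexHull_insert (hYne.image _), convexJoin_singleton_left,
        Set.mem_iUnion₂] at hxY
      obtain ⟨y, hy, hxy⟩ := hxY
      by_cases hyX : y ∈ P.hull {k | μ.reachableSetoid k i}
      · obtain ⟨a, b, h1, h2, h3, h4⟩ := ih (fun l hl => hY l (Set.mem_insert_of_mem _ hl))
          ⟨y, hyX, hy⟩
        exact ⟨a, b, h1, h2, h3, h4.mono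
          (Set.inter_subset_inter_right _ (hull_mono (Set.subset_insert k Y)))⟩
      · obtain ⟨a, b, h1, h2, h3, h4⟩ := exists_edge_inter_segment hk' hyX hx hxy
        refine ⟨a, b, h1, h2, h3, h4.mono (Set.inter_subset_inter_right _ ?_)⟩
        exact (convex_convexHull ℝ _).segment_subset (mem_hull (Set.mem_insert k Y))
          (hull_mono (Set.subset_insert k Y) hy)

theorem boolOfTree_subset_NC {G : SimpleGraph (Fin n)} (hG : P.IsEmbeddedGraph G)
    (hcg : P.HasConvexGeodesics G) : boolOfTree G ⊆ P.NC := by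
  rintro _ ⟨μ, hμ, rfl⟩
  -- A component of `μ` is a subtree of `G`.
  have hcg' : ∀ i k, P.1 k ∈ P.hull {k | μ.reachableSetoid k i} → μ.reachableSetoid k i := by
    intro i k hk
    let T : G.Subgraph :=
      { verts := {k | μ.reachableSetoid k i}
        Adj := fun a b => μ.Adj a b ∧ μ.reachableSetoid a i
        adj_sub := fun h => hμ h.1
        edge_vert := fun h => h.2
        symm := ⟨fun a b h => ⟨h.1.symm, μ.reachableSetoid.trans h.1.symm.reachable h.2⟩⟩ }
    refine hcg T ?_ k hk
    have key : ∀ (a b) (w : μ.Walk a b) (ha : μ.reachableSetoid a i) (hb : μ.reachableSetoid b i),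
        T.coe.Reachable ⟨a, ha⟩ ⟨b, hb⟩ := by
      intro a b w
      induction w with
      | nil => exact fun _ _ => SimpleGraph.Reachable.refl _
      | @cons u v _ hadj _ ih =>
        intro ha hb
        have hv : μ.reachableSetoid v i := μ.reachableSetoid.trans hadj.symm.reachable ha
        have : T.coe.Adj ⟨u, ha⟩ ⟨v, hv⟩ := ⟨hadj, ha⟩
        exact this.reachable.trans (ih hv hb)
    rw [SimpleGraph.Subgraph.connected_iff]
    refine ⟨?_, ⟨i, μ.reachableSetoid.refl i⟩⟩
    rw [SimpleGraph.Subgraph.preconnected_iff]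
    rintro ⟨a, ha⟩ ⟨b, hb⟩
    obtain ⟨w⟩ : μ.Reachable a b := μ.reachableSetoid.trans ha (μ.reachableSetoid.symm hb)
    exact key a b w ha hb
  rintro _ ⟨i, rfl⟩ _ ⟨j, rfl⟩ hij
  have hnr : ¬ μ.reachableSetoid i j := by
    refine fun h => hij ?_
    ext k
    exact ⟨fun hk => μ.reachableSetoid.trans hk h,
      fun hk => μ.reachableSetoid.trans hk (μ.reachableSetoid.symm h)⟩
  have hout : ∀ {i j}, ¬ μ.reachableSetoid i j → ∀ k, μ.reachableSetoid k j →
      P.1 k ∉ P.hull {k | μ.reachableSetoid k i} := fun {i j} hij k hk hki =>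
    hij (μ.reachableSetoid.trans (μ.reachableSetoid.symm (hcg' _ _ hki)) hk)
  have hnr' : ¬ μ.reachableSetoid j i := fun h => hnr (μ.reachableSetoid.symm h)
  rw [Function.onFun, Set.disjoint_iff_inter_eq_empty, ← Set.not_nonempty_iff_eq_empty]
  intro hne
  obtain ⟨a, b, hab, ha, hb, x, hxab, hxj⟩ := exists_edge_inter_hull _ (hout hnr) hne
  obtain ⟨c, d, hcd, hc, hd, y, hycd, hyab⟩ :=
    exists_edge_inter_segment (hout hnr' a ha) (hout hnr' b hb) hxj hxab
  have hyi : y ∈ P.hull {k | μ.reachableSetoid k i} := segment_subset_hull ha hb hyab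
  have hyj : y ∈ P.hull {k | μ.reachableSetoid k j} := segment_subset_hull hc hd hycd
  have hya : y ≠ P.1 a := by rintro rfl; exact hout hnr' a ha hyj
  have hyb : y ≠ P.1 b := by rintro rfl; exact hout hnr' b hb hyj
  have hyc : y ≠ P.1 c := by rintro rfl; exact hout hnr c hc hyi
  have hyd : y ≠ P.1 d := by rintro rfl; exact hout hnr d hd hyi
  rcases hab with rfl | hab
  · rw [segment_same, Set.mem_singleton_iff] at hyab
    exact hya hyab
  rcases hcd with rfl | hcd
  · rw [segment_same, Set.mem_singleton_iff] at hycd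
    exact hyc hycd
  refine Set.disjoint_left.1 (hG.2 a b c d (hμ hab) (hμ hcd) ?_)
    (mem_openSegment_of_ne_left_right hya.symm hyb.symm hyab)
    (mem_openSegment_of_ne_left_right hyc.symm hyd.symm hycd)
  intro heq
  rcases Sym2.eq_iff.1 heq with ⟨rfl, -⟩ | ⟨rfl, -⟩
  · exact hout hnr' a ha (mem_hull hc)
  · exact hout hnr' a ha (mem_hull hd)

end Conf

/-! ### Separating vertices and linked trees -/

section Link

variable {V : Type*}

/-- The vertex `x` separates `u` from `v` in `G`: every walk from `u` to `v` passes through `x`.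
The set `U` is a union of components of `G` without `x`. A vertex separates itself from
every other one. -/
def Separates (G : SimpleGraph V) (x u v : V) : Prop :=
  ∃ U : Set V, (u = x ∨ u ∈ U) ∧ (v = x ∨ v ∉ U) ∧
    ∀ y z, G.Adj y z → y ≠ x → z ≠ x → y ∈ U → z ∈ U

theorem Separates.symm {G : SimpleGraph V} {x u v : V} (h : Separates G x u v) :
    Separates G x v u := by
  obtain ⟨U, h1, h2, h3⟩ := h
  refine ⟨Uᶜ, h2, h1.imp_right fun h => not_not.2 h, fun y z hyz hy hz hyU hzU => hyU ?_⟩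
  exact h3 z y hyz.symm hz hy hzU

theorem Separates.left (G : SimpleGraph V) (x v : V) : Separates G x x v :=
  ⟨∅, Or.inl rfl, Or.inr (Set.notMem_empty v), by simp⟩

theorem Separates.right (G : SimpleGraph V) (x u : V) : Separates G x u x :=
  (Separates.left G x u).symm

theorem Separates.mem_support {G : SimpleGraph V} {x u v : V} (h : Separates G x u v)
    (w : G.Walk u v) : x ∈ w.support := by
  obtain ⟨U, h1, h2, h3⟩ := h
  by_contra hx
  have key : ∀ (a b) (w : G.Walk a b), x ∉ w.support → a ∈ U → b ∈ U := by
    intro a b w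
    induction w with
    | nil => exact fun _ => id
    | cons hadj w ih =>
      intro hx ha
      rw [SimpleGraph.Walk.support_cons, List.mem_cons, not_or] at hx
      exact ih hx.2 (h3 _ _ hadj (Ne.symm hx.1) (fun h => hx.2 (h ▸ w.start_mem_support)) ha)
  have hu : u ∈ U := h1.resolve_left fun h => hx (h ▸ w.start_mem_support)
  have hv : v ∉ U := h2.resolve_left fun h => hx (h ▸ w.end_mem_support)
  exact hv (key u v w hx hu)

/-- The graph obtained from `G` and `H` by adding the edge `ab`. -/
def linkGraph (G H : SimpleGraph V) (a b : V) : SimpleGraph V := G ⊔ H ⊔ SimpleGraph.edge a b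

theorem linkGraph_comm (G H : SimpleGraph V) (a b : V) : linkGraph G H a b = linkGraph H G b a := by
  rw [linkGraph, linkGraph, sup_comm G H, SimpleGraph.edge_comm]

theorem linkGraph_adj {G H : SimpleGraph V} {a b y z : V} (h : (linkGraph G H a b).Adj y z) :
    G.Adj y z ∨ H.Adj y z ∨ (y = a ∧ z = b) ∨ (y = b ∧ z = a) := by
  rw [linkGraph, SimpleGraph.sup_adj, SimpleGraph.sup_adj, SimpleGraph.edge_adj] at h
  tauto

variable {G H : SimpleGraph V} {A B : Set V} {a b : V}

theorem Separates.link_left (hG : ∀ i j, G.Adj i j → i ∈ A) (hH : ∀ i j, H.Adj i j → i ∈ B)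
    (hAB : Disjoint A B) (ha : a ∈ A) (hb : b ∈ B) {x u v : V} (hu : u ∈ A) (hv : v ∈ A)
    (h : Separates G x u v) : Separates (linkGraph G H a b) x u v := by
  obtain ⟨U, h1, h2, h3⟩ := h
  have hd : ∀ w, w ∈ A → w ∉ B := fun w h => Set.disjoint_left.1 hAB h
  refine ⟨{w | (w ∈ U ∧ w ∈ A) ∨ (w ∈ B ∧ a ∈ U)}, h1.imp_right fun h => Or.inl ⟨h, hu⟩,
    h2.imp_right fun h => ?_, ?_⟩
  · rintro (h' | h')
    · exact h h'.1
    · exact hd v hv h'.1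
  · intro y z hyz hy hz hyU
    rcases linkGraph_adj hyz with h | h | ⟨rfl, rfl⟩ | ⟨rfl, rfl⟩
    · rcases hyU with h' | h'
      · exact Or.inl ⟨h3 y z h hy hz h'.1, hG z y h.symm⟩
      · exact (hd y (hG y z h) h'.1).elim
    · rcases hyU with h' | h'
      · exact (hd y h'.2 (hH y z h)).elim
      · exact Or.inr ⟨hH z y h.symm, h'.2⟩
    · rcases hyU with h' | h'
      · exact Or.inr ⟨hb, h'.1⟩
      · exact (hd y ha h'.1).elim
    · rcases hyU with h' | h'
      · exact (hd y h'.2 hb).elim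
      · exact Or.inl ⟨h'.2, ha⟩

theorem Separates.link_cross (hG : ∀ i j, G.Adj i j → i ∈ A) (hH : ∀ i j, H.Adj i j → i ∈ B)
    (hAB : Disjoint A B) (ha : a ∈ A) (hb : b ∈ B) {x u v : V} (hu : u ∈ A) (hv : v ∈ B)
    (h : Separates G x u a) : Separates (linkGraph G H a b) x u v := by
  obtain ⟨U, h1, h2, h3⟩ := h
  have hd : ∀ w, w ∈ A → w ∉ B := fun w h => Set.disjoint_left.1 hAB h
  refine ⟨U ∩ A, h1.imp_right fun h => ⟨h, hu⟩, Or.inr fun h => hd v h.2 hv, ?_⟩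
  intro y z hyz hy hz hyU
  rcases linkGraph_adj hyz with h | h | ⟨rfl, rfl⟩ | ⟨rfl, rfl⟩
  · exact ⟨h3 y z h hy hz hyU.1, hG z y h.symm⟩
  · exact (hd y hyU.2 (hH y z h)).elim
  · exact (h2.resolve_left hy hyU.1).elim
  · exact (hd y hyU.2 hb).elim

theorem Separates.link_right (hG : ∀ i j, G.Adj i j → i ∈ A) (hH : ∀ i j, H.Adj i j → i ∈ B)
    (hAB : Disjoint A B) (ha : a ∈ A) (hb : b ∈ B) {x u v : V} (hu : u ∈ B) (hv : v ∈ B)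
    (h : Separates H x u v) : Separates (linkGraph G H a b) x u v :=
  linkGraph_comm H G b a ▸ h.link_left hH hG hAB.symm hb ha hu hv

theorem Separates.link_cross' (hG : ∀ i j, G.Adj i j → i ∈ A) (hH : ∀ i j, H.Adj i j → i ∈ B)
    (hAB : Disjoint A B) (ha : a ∈ A) (hb : b ∈ B) {x u v : V} (hu : u ∈ A) (hv : v ∈ B)
    (h : Separates H x b v) : Separates (linkGraph G H a b) x u v :=
  (linkGraph_comm H G b a ▸ h.symm.link_cross hH hG hAB.symm hb ha hv hu :
    Separates (linkGraph G H a b) x v u).symm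

/-- The subgraph of the edges of `G` with both ends in the same block of `R`. -/
def withinBlocks (R : Setoid V) (G : SimpleGraph V) : SimpleGraph V where
  Adj i j := G.Adj i j ∧ R i j
  symm := ⟨fun _ _ h => ⟨h.1.symm, R.symm h.2⟩⟩
  loopless := ⟨fun _ h => h.1.ne rfl⟩

theorem withinBlocks_mono {R : Setoid V} (h : G ≤ H) : withinBlocks R G ≤ withinBlocks R H :=
  fun _ _ hij => ⟨h hij.1, hij.2⟩

end Link

/-! ### Trees on intervals of labels -/

/-- The graph `G` is a tree with vertex set `A`, noncrossing for the cyclic order of the labels,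
and its edges within the blocks of `R` connect these blocks. That `G` has no cycles is
encoded by the number of its edges. -/
structure IsCompatibleTree (R : Setoid ℕ) (G : SimpleGraph ℕ) (A : Set ℕ) : Prop where
  mem : ∀ i j, G.Adj i j → i ∈ A
  encard_add_one_le : G.edgeSet.encard + 1 ≤ A.encard
  reachable : ∀ i ∈ A, ∀ j ∈ A, G.Reachable i j
  reachable_within : ∀ i ∈ A, ∀ j ∈ A, R i j → (withinBlocks R G).Reachable i j
  noncrossing : ∀ i j k l, G.Adj i j → G.Adj k l → i < k → k < j → j < l → False

theorem isCompatibleTree_bot (R : Setoid ℕ) (p : ℕ) : IsCompatibleTree R ⊥ (Set.Icc p p) where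
  mem i j h := h.elim
  encard_add_one_le := by simp
  reachable i hi j hj := by
    rw [Set.Icc_self, Set.mem_singleton_iff] at hi hj
    subst hi hj
    exact SimpleGraph.Reachable.refl _
  reachable_within i hi j hj _ := by
    rw [Set.Icc_self, Set.mem_singleton_iff] at hi hj
    subst hi hj
    exact SimpleGraph.Reachable.refl _
  noncrossing i j k l h := h.elim

/-- Two compatible trees are linked to one by an edge `ab`, provided that this creates no crossing,
and that every block which meets both trees contains `a` and `b`. -/
theorem IsCompatibleTree.link {R : Setoid ℕ} {G H : SimpleGraph ℕ} {A B C : Set ℕ} {a b : ℕ}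
    (hG : IsCompatibleTree R G A) (hH : IsCompatibleTree R H B) (hAB : Disjoint A B)
    (hC : A ∪ B = C) (ha : a ∈ A) (hb : b ∈ B)
    (hR : ∀ i ∈ A, ∀ j ∈ B, R i j → R i a ∧ R a b)
    (hncAB : ∀ i ∈ A, ∀ j ∈ A, ∀ k ∈ B, ∀ l ∈ B,
      ¬ (i < k ∧ k < j ∧ j < l) ∧ ¬ (k < i ∧ i < l ∧ l < j))
    (hncA : ∀ i ∈ A, ∀ j ∈ A, ¬ (i < a ∧ a < j ∧ j < b) ∧ ¬ (i < b ∧ b < j ∧ j < a) ∧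
      ¬ (a < i ∧ i < b ∧ b < j) ∧ ¬ (b < i ∧ i < a ∧ a < j))
    (hncB : ∀ i ∈ B, ∀ j ∈ B, ¬ (i < a ∧ a < j ∧ j < b) ∧ ¬ (i < b ∧ b < j ∧ j < a) ∧
      ¬ (a < i ∧ i < b ∧ b < j) ∧ ¬ (b < i ∧ i < a ∧ a < j)) :
    IsCompatibleTree R (linkGraph G H a b) C := by
  subst hC
  have hab : a ≠ b := fun h => Set.disjoint_left.1 hAB ha (h ▸ hb)
  have hGL : G ≤ linkGraph G H a b := le_sup_of_le_left le_sup_left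
  have hHL : H ≤ linkGraph G H a b := le_sup_of_le_left le_sup_right
  have habL : (linkGraph G H a b).Adj a b := by
    refine (le_sup_right : SimpleGraph.edge a b ≤ _) ?_
    simp [SimpleGraph.edge_adj, hab]
  refine ⟨?_, ?_, ?_, ?_, ?_⟩
  · intro i j hij
    rcases linkGraph_adj hij with h | h | ⟨rfl, rfl⟩ | ⟨rfl, rfl⟩
    · exact Or.inl (hG.mem i j h)
    · exact Or.inr (hH.mem i j h)
    · exact Or.inl ha
    · exact Or.inr hb
  · have h1 : (linkGraph G H a b).edgeSet ⊆ (G.edgeSet ∪ H.edgeSet) ∪ {s(a, b)} := by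
      intro e
      induction e using Sym2.ind with
      | h i j =>
        intro hij
        rcases linkGraph_adj hij with h | h | ⟨rfl, rfl⟩ | ⟨rfl, rfl⟩
        · exact Or.inl (Or.inl h)
        · exact Or.inl (Or.inr h)
        · exact Or.inr rfl
        · exact Or.inr Sym2.eq_swap
    rw [Set.encard_union_eq hAB]
    calc (linkGraph G H a b).edgeSet.encard + 1
        ≤ (G.edgeSet.encard + H.edgeSet.encard + 1) + 1 := by
          gcongr
          refine (Set.encard_le_encard h1).trans ((Set.encard_union_le _ _).trans ?_)
          rw [Set.encard_singleton]
          gcongr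
          exact Set.encard_union_le _ _
      _ = (G.edgeSet.encard + 1) + (H.edgeSet.encard + 1) := by ring
      _ ≤ A.encard + B.encard := add_le_add hG.encard_add_one_le hH.encard_add_one_le
  · have hGr : ∀ i ∈ A, (linkGraph G H a b).Reachable i a := fun i hi =>
      (hG.reachable i hi a ha).mono hGL
    have hHr : ∀ i ∈ B, (linkGraph G H a b).Reachable i a := fun i hi =>
      ((hH.reachable i hi b hb).mono hHL).trans habL.symm.reachable
    have hr : ∀ i ∈ A ∪ B, (linkGraph G H a b).Reachable i a := fun i hi =>
      hi.elim (hGr i) (hHr i)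
    exact fun i hi j hj => (hr i hi).trans (hr j hj).symm
  · have hcross : ∀ i ∈ A, ∀ j ∈ B, R i j → (withinBlocks R (linkGraph G H a b)).Reachable i j := by
      intro i hi j hj hij
      obtain ⟨h1, h2⟩ := hR i hi j hj hij
      have h3 : R b j := R.trans (R.symm (R.trans h1 h2)) hij
      have h4 : (withinBlocks R (linkGraph G H a b)).Adj a b := ⟨habL, h2⟩
      exact ((hG.reachable_within i hi a ha h1).mono (withinBlocks_mono hGL)).trans
        (h4.reachable.trans ((hH.reachable_within b hb j hj h3).mono (withinBlocks_mono hHL)))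
    rintro i (hi | hi) j (hj | hj) hij
    · exact (hG.reachable_within i hi j hj hij).mono (withinBlocks_mono hGL)
    · exact hcross i hi j hj hij
    · exact (hcross j hj i hi (R.symm hij)).symm
    · exact (hH.reachable_within i hi j hj hij).mono (withinBlocks_mono hHL)
  · intro i j k l hij hkl h1 h2 h3
    rcases linkGraph_adj hij with h | h | ⟨rfl, rfl⟩ | ⟨rfl, rfl⟩ <;>
      rcases linkGraph_adj hkl with h' | h' | ⟨rfl, rfl⟩ | ⟨rfl, rfl⟩
    · exact hG.noncrossing i j k l h h' h1 h2 h3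
    · exact (hncAB i (hG.mem _ _ h) j (hG.mem _ _ h.symm) k (hH.mem _ _ h') l
        (hH.mem _ _ h'.symm)).1 ⟨h1, h2, h3⟩
    · exact (hncA i (hG.mem _ _ h) j (hG.mem _ _ h.symm)).1 ⟨h1, h2, h3⟩
    · exact (hncA i (hG.mem _ _ h) j (hG.mem _ _ h.symm)).2.1 ⟨h1, h2, h3⟩
    · exact (hncAB k (hG.mem _ _ h') l (hG.mem _ _ h'.symm) i (hH.mem _ _ h) j
        (hH.mem _ _ h.symm)).2 ⟨h1, h2, h3⟩
    · exact hH.noncrossing i j k l h h' h1 h2 h3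
    · exact (hncB i (hH.mem _ _ h) j (hH.mem _ _ h.symm)).1 ⟨h1, h2, h3⟩
    · exact (hncB i (hH.mem _ _ h) j (hH.mem _ _ h.symm)).2.1 ⟨h1, h2, h3⟩
    · exact (hncA k (hG.mem _ _ h') l (hG.mem _ _ h'.symm)).2.2.1 ⟨h1, h2, h3⟩
    · exact (hncB k (hH.mem _ _ h') l (hH.mem _ _ h'.symm)).2.2.1 ⟨h1, h2, h3⟩
    · omega
    · omega
    · exact (hncA k (hG.mem _ _ h') l (hG.mem _ _ h'.symm)).2.2.2 ⟨h1, h2, h3⟩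
    · exact (hncB k (hH.mem _ _ h') l (hH.mem _ _ h'.symm)).2.2.2 ⟨h1, h2, h3⟩
    · omega
    · omega

/-- A compatible tree on the interval of labels from `p` to `q` in which every flat label strictly
inside the interval separates its two neighbors. -/
structure IsGeodesicTree (R : Setoid ℕ) (F : ℕ → Prop) (p q : ℕ) (G : SimpleGraph ℕ) : Prop where
  tree : IsCompatibleTree R G (Set.Icc p q)
  separates : ∀ b, p < b → b < q → F b → Separates G b (b - 1) (b + 1)

/-- The induction statement for the construction of trees. The polygon on the labels from `p` to `q`
has one more side, from `q` to `p`. Unless all labels are on this side, one of `p` and `q`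
is required to separate its two neighbors in the polygon, so that the tree may be linked to others
with this label becoming flat. -/
def HasGeodesicTree (R : Setoid ℕ) (F : ℕ → Prop) (p q : ℕ) : Prop :=
  ∃ G, IsGeodesicTree R F p q G ∧
    ((∃ c, p < c ∧ c < q ∧ ¬ F c) → Separates G p (p + 1) q ∨ Separates G q (q - 1) p)

section Interval

variable {R : Setoid ℕ} {F : ℕ → Prop} {p q : ℕ}

/-- The end `b` at which a tree is linked is chosen such that `p` separates its neighbors if it
becomes flat, and `q` does so unless all labels before it are flat. -/
theorem HasGeodesicTree.exists_left (h : HasGeodesicTree R F p q) :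
    ∃ G b, IsGeodesicTree R F p q G ∧ (b = p ∨ b = q) ∧
      (F p → p < q → Separates G p b (p + 1)) ∧
      ((∃ c, p ≤ c ∧ c < q ∧ ¬ F c) → Separates G q b (q - 1)) := by
  obtain ⟨G, hG, h⟩ := h
  by_cases hc : ∃ c, p < c ∧ c < q ∧ ¬ F c
  · rcases h hc with h | h
    · exact ⟨G, q, hG, Or.inr rfl, fun _ _ => h.symm, fun _ => Separates.left _ _ _⟩
    · exact ⟨G, p, hG, Or.inl rfl, fun _ _ => Separates.left _ _ _, fun _ => h.symm⟩
  · by_cases hp : F p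
    · refine ⟨G, p, hG, Or.inl rfl, fun _ _ => Separates.left _ _ _, fun hc' => (hc ?_).elim⟩
      obtain ⟨c, hpc, hcq, hFc⟩ := hc'
      refine ⟨c, lt_of_le_of_ne hpc ?_, hcq, hFc⟩
      rintro rfl
      exact hFc hp
    · exact ⟨G, q, hG, Or.inr rfl, fun h => (hp h).elim, fun _ => Separates.left _ _ _⟩

theorem HasGeodesicTree.exists_right (h : HasGeodesicTree R F p q) :
    ∃ G a, IsGeodesicTree R F p q G ∧ (a = p ∨ a = q) ∧
      (F q → p < q → Separates G q (q - 1) a) ∧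
      ((∃ c, p < c ∧ c ≤ q ∧ ¬ F c) → Separates G p (p + 1) a) := by
  obtain ⟨G, hG, h⟩ := h
  by_cases hc : ∃ c, p < c ∧ c < q ∧ ¬ F c
  · rcases h hc with h | h
    · exact ⟨G, q, hG, Or.inr rfl, fun _ _ => Separates.right _ _ _, fun _ => h⟩
    · exact ⟨G, p, hG, Or.inl rfl, fun _ _ => h, fun _ => Separates.right _ _ _⟩
  · by_cases hq : F q
    · refine ⟨G, q, hG, Or.inr rfl, fun _ _ => Separates.right _ _ _, fun hc' => (hc ?_).elim⟩
      obtain ⟨c, hpc, hcq, hFc⟩ := hc'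
      refine ⟨c, hpc, lt_of_le_of_ne hcq ?_, hFc⟩
      rintro rfl
      exact hFc hq
    · exact ⟨G, p, hG, Or.inl rfl, fun h => (hq h).elim, fun _ => Separates.right _ _ _⟩

/-- If no block meets both of the intervals of labels up to `m` and after `m`, then trees on these
are linked at suitable ends. -/
theorem exists_geodesicTree_of_split {m : ℕ} (hpm : p ≤ m) (hmq : m < q)
    (hR : ∀ i j, p ≤ i → i ≤ m → m < j → j ≤ q → ¬ R i j)
    (h₁ : HasGeodesicTree R F p m) (h₂ : HasGeodesicTree R F (m + 1) q) :
    ∃ G, IsGeodesicTree R F p q G ∧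
      ((∃ c, p < c ∧ c ≤ m ∧ ¬ F c) → Separates G p (p + 1) q) ∧
      ((∃ c, m < c ∧ c < q ∧ ¬ F c) → Separates G q (q - 1) p) := by
  obtain ⟨G, a, hG, ha, ham, hap⟩ := h₁.exists_right
  obtain ⟨H, b, hH, hb, hbm, hbq⟩ := h₂.exists_left
  have hAB : Disjoint (Set.Icc p m) (Set.Icc (m + 1) q) := by
    rw [Set.disjoint_left]
    intro x hx hx'
    simp only [Set.mem_Icc] at hx hx'
    omega
  have haA : a ∈ Set.Icc p m := by simp only [Set.mem_Icc]; omega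
  have hbB : b ∈ Set.Icc (m + 1) q := by simp only [Set.mem_Icc]; omega
  refine ⟨linkGraph G H a b, ⟨hG.tree.link hH.tree hAB ?_ haA hbB ?_ ?_ ?_ ?_, ?_⟩, ?_, ?_⟩
  · ext x
    simp only [Set.mem_union, Set.mem_Icc]
    omega
  · intro i hi j hj hij
    exact (hR i j hi.1 hi.2 hj.1 hj.2 hij).elim
  · intro i hi j hj k hk l hl
    simp only [Set.mem_Icc] at hi hj hk hl
    omega
  · intro i hi j hj
    simp only [Set.mem_Icc] at hi hj
    omega
  · intro i hi j hj
    simp only [Set.mem_Icc] at hi hj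
    omega
  · intro x hpx hxq hx
    rcases lt_trichotomy x m with hxm | rfl | hxm
    · exact (hG.separates x hpx hxm hx).link_left hG.tree.mem hH.tree.mem hAB haA hbB
        (by simp only [Set.mem_Icc]; omega) (by simp only [Set.mem_Icc]; omega)
    · exact (ham hx hpx).link_cross hG.tree.mem hH.tree.mem hAB haA hbB
        (by simp only [Set.mem_Icc]; omega) (by simp only [Set.mem_Icc]; omega)
    · rcases eq_or_lt_of_le (Nat.succ_le_of_lt hxm) with rfl | hxm
      · exact (hbm hx hxq).link_cross' hG.tree.mem hH.tree.mem hAB haA hbB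
          (by simp only [Set.mem_Icc]; omega) (by simp only [Set.mem_Icc]; omega)
      · exact (hH.separates x hxm hxq hx).link_right hG.tree.mem hH.tree.mem hAB haA hbB
          (by simp only [Set.mem_Icc]; omega) (by simp only [Set.mem_Icc]; omega)
  · rintro ⟨c, hpc, hcm, hc⟩
    exact (hap ⟨c, hpc, hcm, hc⟩).link_cross hG.tree.mem hH.tree.mem hAB haA hbB
      (by simp only [Set.mem_Icc]; omega) (by simp only [Set.mem_Icc]; omega)
  · rintro ⟨c, hmc, hcq, hc⟩
    exact ((hbq ⟨c, hmc, hcq, hc⟩).link_cross' hG.tree.mem hH.tree.mem hAB haA hbB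
      (by simp only [Set.mem_Icc]; omega) (by simp only [Set.mem_Icc]; omega)).symm

/-- If `p`, `p + 1` and `q` are in the same block, then `p` is added as a leaf at `p + 1` or `q`. -/
theorem exists_geodesicTree_of_leaf (hpq : p < q) (hR : R p q) (hR' : R p (p + 1))
    (h : HasGeodesicTree R F (p + 1) q) :
    ∃ G, IsGeodesicTree R F p q G ∧
      ((∃ c, p < c ∧ c < q ∧ ¬ F c) → Separates G q (q - 1) p) := by
  obtain ⟨H, b, hH, hb, hbp, hbq⟩ := h.exists_left
  have hG := isCompatibleTree_bot R p
  have hAB : Disjoint (Set.Icc p p) (Set.Icc (p + 1) q) := by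
    rw [Set.disjoint_left]
    intro x hx hx'
    simp only [Set.mem_Icc] at hx hx'
    omega
  have haA : p ∈ Set.Icc p p := by simp
  have hbB : b ∈ Set.Icc (p + 1) q := by simp only [Set.mem_Icc]; omega
  refine ⟨linkGraph ⊥ H p b, ⟨hG.link hH.tree hAB ?_ haA hbB ?_ ?_ ?_ ?_, ?_⟩, ?_⟩
  · ext x
    simp only [Set.mem_union, Set.mem_Icc]
    omega
  · intro i hi j hj hij
    rw [Set.Icc_self, Set.mem_singleton_iff] at hi
    subst hi
    refine ⟨R.refl _, ?_⟩
    rcases hb with rfl | rfl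
    · exact hR'
    · exact hR
  · intro i hi j hj k hk l hl
    simp only [Set.mem_Icc] at hi hj hk hl
    omega
  · intro i hi j hj
    simp only [Set.mem_Icc] at hi hj
    omega
  · intro i hi j hj
    simp only [Set.mem_Icc] at hi hj
    omega
  · intro x hpx hxq hx
    rcases eq_or_lt_of_le (Nat.succ_le_of_lt hpx) with rfl | hxm
    · exact (hbp hx hxq).link_cross' hG.mem hH.tree.mem hAB haA hbB
        (by simp only [Set.mem_Icc]; omega) (by simp only [Set.mem_Icc]; omega)
    · exact (hH.separates x hxm hxq hx).link_right hG.mem hH.tree.mem hAB haA hbB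
        (by simp only [Set.mem_Icc]; omega) (by simp only [Set.mem_Icc]; omega)
  · rintro ⟨c, hpc, hcq, hc⟩
    exact ((hbq ⟨c, hpc, hcq, hc⟩).link_cross' hG.mem hH.tree.mem hAB haA hbB
      (by simp only [Set.mem_Icc]; omega) (by simp only [Set.mem_Icc]; omega)).symm

/-- If `p` and `q` are in the same block, and `r > p + 1` is the next label of this block, then `p`
is added to a tree on the labels from `r` to `q` as a leaf at `q`, and a tree on the labels between
`p` and `r` is linked to `r`. -/
theorem exists_geodesicTree_of_gap {r : ℕ} (hpr : p + 1 < r) (hrq : r ≤ q) (hR : R p q)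
    (hRr : ∀ i j, p < i → i < r → (j = p ∨ r ≤ j) → j ≤ q → ¬ R j i)
    (hF : ∃ c, p < c ∧ c < r ∧ ¬ F c)
    (h₁ : HasGeodesicTree R F (p + 1) (r - 1)) (h₂ : HasGeodesicTree R F r q) :
    ∃ G, IsGeodesicTree R F p q G ∧ Separates G q (q - 1) p := by
  obtain ⟨D, x, hD, hx, hxp, hxr⟩ := h₁.exists_left
  obtain ⟨H, hH, -⟩ := h₂
  have hG := isCompatibleTree_bot R p
  have hAB : Disjoint (Set.Icc p p) (Set.Icc r q) := by
    rw [Set.disjoint_left]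
    intro x hx hx'
    simp only [Set.mem_Icc] at hx hx'
    omega
  have hp : p ∈ Set.Icc p p := by simp
  have hq : q ∈ Set.Icc r q := by simp only [Set.mem_Icc]; omega
  have hL : IsCompatibleTree R (linkGraph ⊥ H p q) (Set.Icc p p ∪ Set.Icc r q) := by
    refine hG.link hH.tree hAB rfl hp hq ?_ ?_ ?_ ?_
    · intro i hi j hj hij
      rw [Set.Icc_self, Set.mem_singleton_iff] at hi
      subst hi
      exact ⟨R.refl _, hR⟩
    · intro i hi j hj k hk l hl
      simp only [Set.mem_Icc] at hi hj hk hl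
      omega
    · intro i hi j hj
      simp only [Set.mem_Icc] at hi hj
      omega
    · intro i hi j hj
      simp only [Set.mem_Icc] at hi hj
      omega
  have hAB' : Disjoint (Set.Icc p p ∪ Set.Icc r q) (Set.Icc (p + 1) (r - 1)) := by
    rw [Set.disjoint_left]
    intro x hx hx'
    simp only [Set.mem_union, Set.mem_Icc] at hx hx'
    omega
  have hr : r ∈ Set.Icc p p ∪ Set.Icc r q := by
    simp only [Set.mem_union, Set.mem_Icc]; omega
  have hxD : x ∈ Set.Icc (p + 1) (r - 1) := by simp only [Set.mem_Icc]; omega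
  refine ⟨linkGraph (linkGraph ⊥ H p q) D r x, ⟨hL.link hD.tree hAB' ?_ hr hxD ?_ ?_ ?_ ?_, ?_⟩, ?_⟩
  · ext x
    simp only [Set.mem_union, Set.mem_Icc]
    omega
  · intro i hi j hj hij
    simp only [Set.mem_union, Set.mem_Icc] at hi hj
    exact (hRr j i (by omega) (by omega) (by omega) (by omega) hij).elim
  · intro i hi j hj k hk l hl
    simp only [Set.mem_union, Set.mem_Icc] at hi hj hk hl
    omega
  · intro i hi j hj
    simp only [Set.mem_union, Set.mem_Icc] at hi hj
    omega
  · intro i hi j hj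
    simp only [Set.mem_Icc] at hi hj
    omega
  · intro b hpb hbq hb
    obtain ⟨c, hpc, hcr, hc⟩ := hF
    rcases lt_trichotomy b r with hbr | rfl | hbr
    · rcases eq_or_lt_of_le (Nat.succ_le_of_lt hpb) with rfl | hpb'
      · have : c ≠ p + 1 := by rintro rfl; exact hc hb
        exact (hxp hb (by omega)).link_cross' hL.mem hD.tree.mem hAB' hr hxD
          (by simp only [Set.mem_union, Set.mem_Icc]; omega) (by simp only [Set.mem_Icc]; omega)
      · rcases eq_or_lt_of_le (Nat.le_sub_one_of_lt hbr) with rfl | hbr'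
        · have : c ≠ r - 1 := by rintro rfl; exact hc hb
          have h := (hxr ⟨c, hpc, by omega, hc⟩).link_cross' (u := r - 1 + 1) hL.mem hD.tree.mem hAB'
            hr hxD (by simp only [Set.mem_union, Set.mem_Icc]; omega)
            (by simp only [Set.mem_Icc]; omega)
          exact h.symm
        · exact (hD.separates b hpb' hbr' hb).link_right hL.mem hD.tree.mem hAB' hr hxD
            (by simp only [Set.mem_Icc]; omega) (by simp only [Set.mem_Icc]; omega)
    · exact ((Separates.right _ b (b + 1)).link_cross hL.mem hD.tree.mem hAB' hr hxD
        (by simp only [Set.mem_union, Set.mem_Icc]; omega)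
        (by simp only [Set.mem_Icc]; omega)).symm
    · exact ((hH.separates b hbr hbq hb).link_right hG.mem hH.tree.mem hAB hp hq
        (by simp only [Set.mem_Icc]; omega) (by simp only [Set.mem_Icc]; omega)).link_left
        hL.mem hD.tree.mem hAB' hr hxD (by simp only [Set.mem_union, Set.mem_Icc]; omega)
        (by simp only [Set.mem_union, Set.mem_Icc]; omega)
  · rcases eq_or_lt_of_le hrq with rfl | hrq'
    · exact ((Separates.right _ r p).link_cross hL.mem hD.tree.mem hAB' hr hxD
        (by simp only [Set.mem_union, Set.mem_Icc]; omega)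
        (by simp only [Set.mem_Icc]; omega)).symm
    · exact (((Separates.left _ q (q - 1)).link_cross' hG.mem hH.tree.mem hAB hp hq hp
        (by simp only [Set.mem_Icc]; omega)).link_left
        hL.mem hD.tree.mem hAB' hr hxD (by simp only [Set.mem_union, Set.mem_Icc]; omega)
        (by simp only [Set.mem_union, Set.mem_Icc]; omega)).symm

variable {N : ℕ}

theorem exists_geodesicTree_of_rel
    (hnc : ∀ i j k l, i < j → j < k → k < l → l ≤ N → R i k → R j l → R i j)
    (hflat : ∀ a b c, a < b → b < c → c ≤ N → (∀ x, a < x → x < c → F x) → R a c → R a b)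
    (hpq : p < q) (hqN : q ≤ N) (hR : R p q)
    (ih : ∀ p' q', p ≤ p' → p' ≤ q' → q' ≤ q → q' - p' < q - p → HasGeodesicTree R F p' q') :
    ∃ G, IsGeodesicTree R F p q G ∧
      ((∃ c, p < c ∧ c < q ∧ ¬ F c) → Separates G q (q - 1) p) := by
  classical
  by_cases hR' : R p (p + 1)
  · exact exists_geodesicTree_of_leaf hpq hR hR' (ih _ _ (by omega) (by omega) (by omega) (by omega))
  · have hex : ∃ r, p < r ∧ R p r := ⟨q, hpq, hR⟩
    let r := Nat.find hex
    obtain ⟨hpr, hRr⟩ : p < r ∧ R p r := Nat.find_spec hex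
    have hmin : ∀ i, p < i → i < r → ¬ R p i := fun i hi hir h => Nat.find_min hex hir ⟨hi, h⟩
    have hrq : r ≤ q := Nat.find_min' hex ⟨hpq, hR⟩
    have hpr' : p + 1 < r := by
      refine lt_of_le_of_ne hpr fun h => hR' ?_
      rw [show p + 1 = r from h]
      exact hRr
    have hF : ∃ c, p < c ∧ c < r ∧ ¬ F c := by
      by_contra! hcon
      exact hR' (hflat p (p + 1) r (by omega) hpr' (by omega) hcon hRr)
    have hout : ∀ i j, p < i → i < r → (j = p ∨ r ≤ j) → j ≤ q → ¬ R j i := by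
      intro i j hpi hir hj hjq hji
      have : R j p := by
        rcases hj with rfl | hrj
        · exact R.refl _
        · rcases eq_or_lt_of_le hrj with rfl | hrj
          · exact R.symm hRr
          · exact (hmin i hpi hir (hnc p i r j hpi hir hrj (by omega) hRr (R.symm hji))).elim
      exact hmin i hpi hir (R.trans (R.symm this) hji)
    obtain ⟨G, hG, hGq⟩ := exists_geodesicTree_of_gap hpr' hrq hR hout hF
      (ih (p + 1) (r - 1) (by omega) (by omega) (by omega) (by omega))
      (ih r q (by omega) (by omega) (by omega) (by omega))
    exact ⟨G, hG, fun _ => hGq⟩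

/-- If `p` and `q` are in different blocks, then no block meets both the labels up to the last label
`m` in the block of `p` and those after it. -/
theorem exists_split_of_not_rel
    (hnc : ∀ i j k l, i < j → j < k → k < l → l ≤ N → R i k → R j l → R i j)
    (hpq : p < q) (hqN : q ≤ N) (hR : ¬ R p q) :
    ∃ m, p ≤ m ∧ m < q ∧ R p m ∧ ∀ i j, p ≤ i → i ≤ m → m < j → j ≤ q → ¬ R i j := by
  classical
  let m := Nat.findGreatest (R p) q
  have hRm : R p m := Nat.findGreatest_spec hpq.le (R.refl p)
  have hpm : p ≤ m := Nat.le_findGreatest hpq.le (R.refl p)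
  have hmq : m ≤ q := Nat.findGreatest_le q
  have hmax : ∀ j, m < j → j ≤ q → ¬ R p j := fun j h h' => Nat.findGreatest_is_greatest h h'
  refine ⟨m, hpm, lt_of_le_of_ne hmq fun h => hR (h ▸ hRm), hRm, ?_⟩
  intro i j hpi him hmj hjq hij
  refine hmax j hmj hjq (R.trans ?_ hij)
  rcases eq_or_lt_of_le hpi with rfl | hpi
  · exact R.refl _
  rcases eq_or_lt_of_le him with rfl | him
  · exact hRm
  exact hnc p i m j hpi him hmj (by omega) hRm hij

theorem hasGeodesicTree
    (hnc : ∀ i j k l, i < j → j < k → k < l → l ≤ N → R i k → R j l → R i j)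
    (hflat : ∀ a b c, a < b → b < c → c ≤ N → (∀ x, a < x → x < c → F x) → R a c → R a b) :
    ∀ d p q, q - p = d → p ≤ q → q ≤ N → HasGeodesicTree R F p q := by
  intro d
  induction d using Nat.strong_induction_on with
  | h d ih =>
    intro p q hd hpq hqN
    have ih' : ∀ p' q', p ≤ p' → p' ≤ q' → q' ≤ q → q' - p' < q - p → HasGeodesicTree R F p' q' :=
      fun p' q' h1 h2 h3 h4 => ih (q' - p') (by omega) p' q' rfl h2 (by omega)
    rcases eq_or_lt_of_le hpq with rfl | hpq
    · exact ⟨⊥, ⟨isCompatibleTree_bot R p, fun b h1 h2 => by omega⟩, fun ⟨c, h1, h2, _⟩ => by omega⟩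
    by_cases hR : R p q
    · obtain ⟨G, hG, h⟩ := exists_geodesicTree_of_rel hnc hflat hpq hqN hR ih'
      exact ⟨G, hG, fun hc => Or.inr (h hc)⟩
    · obtain ⟨m, hpm, hmq, -, hm⟩ := exists_split_of_not_rel hnc hpq hqN hR
      obtain ⟨G, hG, h1, h2⟩ := exists_geodesicTree_of_split hpm hmq hm
        (ih' p m (by omega) (by omega) (by omega) (by omega))
        (ih' (m + 1) q (by omega) (by omega) (by omega) (by omega))
      refine ⟨G, hG, ?_⟩
      rintro ⟨c, hpc, hcq, hc⟩
      rcases le_or_gt c m with hcm | hcm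
      · exact Or.inl (h1 ⟨c, hpc, hcm, hc⟩)
      · exact Or.inr (h2 ⟨c, hcm, hcq, hc⟩)

/-- The tree for the whole polygon. The label `N` may be flat too, between `N - 1` and `0`, which is
the condition `L`. -/
theorem exists_geodesicTree {L : Prop}
    (hnc : ∀ i j k l, i < j → j < k → k < l → l ≤ N → R i k → R j l → R i j)
    (hflat : ∀ a b c, a < b → b < c → c ≤ N → (∀ x, a < x → x < c → F x) → R a c → R a b)
    (hL : L → ∃ c, 0 < c ∧ c < N ∧ ¬ F c)
    (hflat' : L → ∀ a b, 0 < a → a < b → b ≤ N → (∀ x, a < x → x < N → F x) → R 0 a → R 0 b) :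
    ∃ G, IsGeodesicTree R F 0 N G ∧ (L → Separates G N (N - 1) 0) := by
  have h := fun p q h => hasGeodesicTree (R := R) (F := F) hnc hflat (q - p) p q rfl h
  rcases Nat.eq_zero_or_pos N with rfl | hN
  · obtain ⟨G, hG, -⟩ := h 0 0 le_rfl le_rfl
    exact ⟨G, hG, fun _ => Separates.left _ _ _⟩
  by_cases hR : R 0 N
  · obtain ⟨G, hG, h⟩ := exists_geodesicTree_of_rel hnc hflat hN le_rfl hR
      fun p q _ h2 h3 _ => h p q h2 h3
    exact ⟨G, hG, fun hl => h (hL hl)⟩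
  · obtain ⟨m, hpm, hmN, hRm, hm⟩ := exists_split_of_not_rel hnc hN le_rfl hR
    obtain ⟨G, hG, -, h2⟩ := exists_geodesicTree_of_split hpm hmN hm (h 0 m hpm hmN.le)
      (h (m + 1) N hmN le_rfl)
    refine ⟨G, hG, fun hl => h2 ?_⟩
    by_contra! hcon
    rcases Nat.eq_zero_or_pos m with rfl | hm0
    · obtain ⟨c, hc0, hcN, hc⟩ := hL hl
      exact hc (hcon c hc0 hcN)
    · exact hm 0 (m + 1) le_rfl hpm (by omega) hmN
        (hflat' hl m (m + 1) hm0 (by omega) hmN hcon hRm)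

end Interval

/-! ### Labelling points in weakly convex position along the boundary -/

section Labelling

variable {ι : Type*}

/-- Twice the signed area of the triangle with vertices `i`, `j`, `k`. -/
def orient (x y : ι → ℝ) (i j k : ι) : ℝ := (x j - x i) * (y k - y i) - (y j - y i) * (x k - x i)

/-- The point `j` lies strictly between the points `i` and `k` on a line. As the first coordinates
of the points are assumed to be distinct, they decide about the position on the line. -/
def LiesBetween (x y : ι → ℝ) (i j k : ι) : Prop :=
  orient x y i j k = 0 ∧ ((x i < x j ∧ x j < x k) ∨ (x k < x j ∧ x j < x i))

theorem eq_zero_of_det_ne_zero {α β u₁ v₁ u₂ v₂ : ℝ} (hdet : u₁ * v₂ - v₁ * u₂ ≠ 0)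
    (h₁ : α * u₁ + β * v₁ = 0) (h₂ : α * u₂ + β * v₂ = 0) : α = 0 ∧ β = 0 := by
  constructor
  · have : α * (u₁ * v₂ - v₁ * u₂) = 0 := by linear_combination v₂ * h₁ - v₁ * h₂
    exact (mul_eq_zero.1 this).resolve_right hdet
  · have : β * (u₁ * v₂ - v₁ * u₂) = 0 := by linear_combination u₁ * h₂ - u₂ * h₁
    exact (mul_eq_zero.1 this).resolve_right hdet

section Slope

variable {x y : ι → ℝ} {p : ι}

/-- The slope of the line through `p` and `i`. -/
noncomputable def slopeFrom (x y : ι → ℝ) (p i : ι) : ℝ := (y i - y p) / (x i - x p)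

/-- The slope at `p` of the point `i` is not minimal. -/
def NotLowest (x y : ι → ℝ) (p i : ι) : Prop := ∃ v, v ≠ p ∧ slopeFrom x y p v < slopeFrom x y p i

/-- The counterclockwise order of the points as seen from the leftmost point `p`. Points in the same
direction are on a side of the convex hull; they are ordered away from `p` on the first side,
and towards `p` on the last one. -/
def BoundaryLT (x y : ι → ℝ) (p i j : ι) : Prop :=
  slopeFrom x y p i < slopeFrom x y p j ∨ (slopeFrom x y p i = slopeFrom x y p j ∧
    ((NotLowest x y p i ∧ x j < x i) ∨ (¬ NotLowest x y p i ∧ x i < x j)))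

theorem sub_eq_slopeFrom_mul {i : ι} (h : x p < x i) :
    y i - y p = slopeFrom x y p i * (x i - x p) := by
  rw [slopeFrom, div_mul_cancel₀ _ (sub_pos.2 h).ne']

theorem orient_eq_slopeFrom {i j : ι} (hi : x p < x i) (hj : x p < x j) :
    orient x y p i j =
      (x i - x p) * (x j - x p) * (slopeFrom x y p j - slopeFrom x y p i) := by
  have ei := sub_eq_slopeFrom_mul (y := y) hi
  have ej := sub_eq_slopeFrom_mul (y := y) hj
  rw [orient]
  linear_combination (x i - x p) * ej - (x j - x p) * ei

theorem orient_eq_add (x y : ι → ℝ) (p i j k : ι) :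
    orient x y i j k = orient x y p i j + orient x y p j k - orient x y p i k := by
  simp only [orient]
  ring

theorem BoundaryLT.le {i j : ι} (h : BoundaryLT x y p i j) :
    slopeFrom x y p i ≤ slopeFrom x y p j := h.elim le_of_lt fun h => h.1.le

theorem orient_nonneg_of_boundaryLT {i j : ι} (hi : x p < x i) (hj : x p < x j)
    (h : BoundaryLT x y p i j) : 0 ≤ orient x y p i j := by
  rw [orient_eq_slopeFrom hi hj]
  exact mul_nonneg (mul_nonneg (sub_pos.2 hi).le (sub_pos.2 hj).le) (sub_nonneg.2 h.le)

theorem slopeFrom_eq_of_orient_eq_zero {i j : ι} (hi : x p < x i) (hj : x p < x j)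
    (h : orient x y p i j = 0) : slopeFrom x y p i = slopeFrom x y p j := by
  rw [orient_eq_slopeFrom hi hj, mul_eq_zero, mul_eq_zero] at h
  rcases h with (h | h) | h
  · exact ((sub_pos.2 hi).ne' h).elim
  · exact ((sub_pos.2 hj).ne' h).elim
  · exact (sub_eq_zero.1 h).symm

/-- The points have a supporting line at `i`. -/
def HasSupport (x y : ι → ℝ) (i : ι) : Prop :=
  ∃ α β : ℝ, (α ≠ 0 ∨ β ≠ 0) ∧ ∀ k, α * (x k - x i) + β * (y k - y i) ≤ 0

/-- Otherwise `j` is inside the triangle with vertices `p`, `i`, `k`. -/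
theorem orient_nonneg_of_slopeFrom_lt {i j k : ι} (hi : x p < x i) (hj : x p < x j)
    (hk : x p < x k) (hs : HasSupport x y j) (hij : slopeFrom x y p i < slopeFrom x y p j)
    (hjk : slopeFrom x y p j < slopeFrom x y p k) : 0 ≤ orient x y i j k := by
  by_contra! hneg
  obtain ⟨α, β, hne, hs⟩ := hs
  have hpij : 0 < orient x y p i j := by
    rw [orient_eq_slopeFrom hi hj]
    exact mul_pos (mul_pos (sub_pos.2 hi) (sub_pos.2 hj)) (sub_pos.2 hij)
  have hpjk : 0 < orient x y p j k := by
    rw [orient_eq_slopeFrom hj hk]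
    exact mul_pos (mul_pos (sub_pos.2 hj) (sub_pos.2 hk)) (sub_pos.2 hjk)
  have hsum : -orient x y i j k * (α * (x p - x j) + β * (y p - y j)) +
      orient x y p j k * (α * (x i - x j) + β * (y i - y j)) +
      orient x y p i j * (α * (x k - x j) + β * (y k - y j)) = 0 := by
    simp only [orient]
    ring
  have h1 := mul_nonpos_of_nonneg_of_nonpos (neg_pos.2 hneg).le (hs p)
  have h2 := mul_nonpos_of_nonneg_of_nonpos hpjk.le (hs i)
  have h3 := mul_nonpos_of_nonneg_of_nonpos hpij.le (hs k)
  have hp0 : α * (x p - x j) + β * (y p - y j) = 0 :=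
    (mul_eq_zero.1 (by linarith :
      -orient x y i j k * (α * (x p - x j) + β * (y p - y j)) = 0)).resolve_left (neg_pos.2 hneg).ne'
  have hk0 : α * (x k - x j) + β * (y k - y j) = 0 :=
    (mul_eq_zero.1 (by linarith :
      orient x y p i j * (α * (x k - x j) + β * (y k - y j)) = 0)).resolve_left hpij.ne'
  have hdet : (x p - x j) * (y k - y j) - (y p - y j) * (x k - x j) ≠ 0 := by
    have : (x p - x j) * (y k - y j) - (y p - y j) * (x k - x j) = -orient x y p j k := by
      simp only [orient]; ring
    rw [this]
    exact (neg_neg_of_pos hpjk).ne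
  obtain ⟨h, h'⟩ := eq_zero_of_det_ne_zero hdet hp0 hk0
  exact hne.elim (fun hα => hα h) fun hβ => hβ h'

/-- A point `j` between `p` and another point `i` is on a side of the convex hull, so there are not
points on both sides of the line. -/
theorem not_lt_of_slopeFrom_eq {i j k v : ι} (hi : x p < x i) (hj : x p < x j)
    (hk : x p < x k) (hv : x p < x v) (hs : HasSupport x y j)
    (hij : slopeFrom x y p i = slopeFrom x y p j) (hjk : slopeFrom x y p j < slopeFrom x y p k)
    (hvj : slopeFrom x y p v < slopeFrom x y p j) : ¬ x j < x i := by
  intro hlt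
  obtain ⟨α, β, hne, hs⟩ := hs
  have ei := sub_eq_slopeFrom_mul (y := y) hi
  have ej := sub_eq_slopeFrom_mul (y := y) hj
  have ek := sub_eq_slopeFrom_mul (y := y) hk
  have ev := sub_eq_slopeFrom_mul (y := y) hv
  rw [hij] at ei
  set s := slopeFrom x y p j
  have h0 : α + β * s = 0 := by
    have h1 : 0 ≤ (α + β * s) * (x j - x p) := by
      have := hs p
      have e : α * (x p - x j) + β * (y p - y j) = -((α + β * s) * (x j - x p)) := by
        linear_combination -β * ej
      linarith
    have h2 : (α + β * s) * (x i - x j) ≤ 0 := by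
      have := hs i
      have e : α * (x i - x j) + β * (y i - y j) = (α + β * s) * (x i - x j) := by
        linear_combination β * ei - β * ej
      linarith
    exact le_antisymm (nonpos_of_mul_nonpos_left h2 (sub_pos.2 hlt))
      (nonneg_of_mul_nonneg_left h1 (sub_pos.2 hj))
  have hw : ∀ w, y w - y p = slopeFrom x y p w * (x w - x p) →
      β * (slopeFrom x y p w - s) * (x w - x p) ≤ 0 := by
    intro w ew
    have := hs w
    have e : α * (x w - x j) + β * (y w - y j) = β * (slopeFrom x y p w - s) * (x w - x p) := by
      linear_combination β * ew - β * ej + (x w - x j) * h0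
    linarith
  have h1 : β * (slopeFrom x y p k - s) ≤ 0 :=
    nonpos_of_mul_nonpos_left (hw k ek) (sub_pos.2 hk)
  have h2 : β * (slopeFrom x y p v - s) ≤ 0 :=
    nonpos_of_mul_nonpos_left (hw v ev) (sub_pos.2 hv)
  have hβ : β = 0 := by nlinarith
  have hα : α = 0 := by rw [hβ] at h0; linarith
  exact hne.elim (fun h => h hα) fun h => h hβ

/-- The order of the points as seen from `p` is their order along the boundary. -/
theorem orient_of_boundaryLT (hinj : Function.Injective x) (hp : ∀ i, i ≠ p → x p < x i)
    (hs : ∀ i, HasSupport x y i) {i j k : ι} (hi : i ≠ p) (hj : j ≠ p) (hk : k ≠ p)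
    (hij : BoundaryLT x y p i j) (hjk : BoundaryLT x y p j k) :
    0 ≤ orient x y i j k ∧ (orient x y i j k = 0 → LiesBetween x y i j k) := by
  have hi' := hp i hi
  have hj' := hp j hj
  have hk' := hp k hk
  have e := orient_eq_add x y p i j k
  rw [orient_eq_slopeFrom hi' hj', orient_eq_slopeFrom hj' hk', orient_eq_slopeFrom hi' hk'] at e
  have ai := sub_pos.2 hi'
  have aj := sub_pos.2 hj'
  have ak := sub_pos.2 hk'
  rcases hij with hij | ⟨hij, hij'⟩ <;> rcases hjk with hjk | ⟨hjk, hjk'⟩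
  · refine ⟨orient_nonneg_of_slopeFrom_lt hi' hj' hk' (hs j) hij hjk, fun h0 => ⟨h0, ?_⟩⟩
    rw [h0] at e
    have d1 := sub_pos.2 hij
    have d2 := sub_pos.2 hjk
    have hpos : 0 < (x i - x p) * (slopeFrom x y p j - slopeFrom x y p i) +
        (x k - x p) * (slopeFrom x y p k - slopeFrom x y p j) :=
      add_pos (mul_pos ai d1) (mul_pos ak d2)
    have e1 : (x j - x i) * ((x i - x p) * (slopeFrom x y p j - slopeFrom x y p i) +
        (x k - x p) * (slopeFrom x y p k - slopeFrom x y p j)) =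
        (x i - x p) * (slopeFrom x y p j - slopeFrom x y p i) * (x k - x i) := by
      linear_combination -e
    have e2 : (x k - x j) * ((x i - x p) * (slopeFrom x y p j - slopeFrom x y p i) +
        (x k - x p) * (slopeFrom x y p k - slopeFrom x y p j)) =
        (x k - x p) * (slopeFrom x y p k - slopeFrom x y p j) * (x k - x i) := by
      linear_combination e
    have hik : x i ≠ x k := by
      intro h
      have := hinj h
      rw [this] at hij
      exact lt_asymm hij hjk
    rcases lt_or_gt_of_ne hik with hik | hik
    · left
      constructor
      · have := mul_pos (mul_pos ai d1) (sub_pos.2 hik)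
        rw [← e1] at this
        exact sub_pos.1 ((pos_iff_pos_of_mul_pos this).2 hpos)
      · have := mul_pos (mul_pos ak d2) (sub_pos.2 hik)
        rw [← e2] at this
        exact sub_pos.1 ((pos_iff_pos_of_mul_pos this).2 hpos)
    · right
      constructor
      · have := mul_pos (mul_pos ak d2) (sub_pos.2 hik)
        have e2' : (x k - x p) * (slopeFrom x y p k - slopeFrom x y p j) * (x i - x k) =
          (x j - x k) * ((x i - x p) * (slopeFrom x y p j - slopeFrom x y p i) +
            (x k - x p) * (slopeFrom x y p k - slopeFrom x y p j)) := by linear_combination e2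
        rw [e2'] at this
        exact sub_pos.1 ((pos_iff_pos_of_mul_pos this).2 hpos)
      · have := mul_pos (mul_pos ai d1) (sub_pos.2 hik)
        have e1' : (x i - x p) * (slopeFrom x y p j - slopeFrom x y p i) * (x i - x k) =
          (x i - x j) * ((x i - x p) * (slopeFrom x y p j - slopeFrom x y p i) +
            (x k - x p) * (slopeFrom x y p k - slopeFrom x y p j)) := by linear_combination e1
        rw [e1'] at this
        exact sub_pos.1 ((pos_iff_pos_of_mul_pos this).2 hpos)
  · have hkj : x k < x j := by
      rcases hjk' with h | h
      · exact h.2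
      · exact (h.1 ⟨i, hi, hij⟩).elim
    have hpos : 0 < orient x y i j k := by
      rw [e, ← hjk]
      have := mul_pos (mul_pos ai (sub_pos.2 hij)) (sub_pos.2 hkj)
      linarith
    exact ⟨hpos.le, fun h => (hpos.ne' h).elim⟩
  · have hij'' : x i < x j := by
      rcases hij' with ⟨⟨v, hv, hvi⟩, h⟩ | h
      · exact (not_lt_of_slopeFrom_eq hi' hj' hk' (hp v hv) (hs j) hij hjk (hij ▸ hvi) h).elim
      · exact h.2
    have hpos : 0 < orient x y i j k := by
      rw [e, hij]
      have := mul_pos (mul_pos ak (sub_pos.2 hjk)) (sub_pos.2 hij'')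
      linarith
    exact ⟨hpos.le, fun h => (hpos.ne' h).elim⟩
  · have h0 : orient x y i j k = 0 := by rw [e, hij, hjk]; ring
    refine ⟨h0.ge, fun _ => ⟨h0, ?_⟩⟩
    rcases hij' with ⟨hl, h⟩ | ⟨hl, h⟩ <;> rcases hjk' with ⟨hl', h'⟩ | ⟨hl', h'⟩
    · exact Or.inr ⟨h', h⟩
    · exact (hl' (by rw [NotLowest, ← hij]; exact hl)).elim
    · exact (hl (by rw [NotLowest, hij]; exact hl')).elim
    · exact Or.inl ⟨h, h'⟩

theorem liesBetween_of_boundaryLT (hp : ∀ i, i ≠ p → x p < x i) {i j : ι} (hi : i ≠ p) (hj : j ≠ p)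
    (hij : BoundaryLT x y p i j) (h0 : orient x y p i j = 0) :
    (NotLowest x y p i ↔ NotLowest x y p j) ∧ (NotLowest x y p j → LiesBetween x y i j p) ∧
      (¬ NotLowest x y p j → LiesBetween x y p i j) := by
  have heq := slopeFrom_eq_of_orient_eq_zero (hp i hi) (hp j hj) h0
  have hiff : NotLowest x y p i ↔ NotLowest x y p j := by rw [NotLowest, heq]; rfl
  have h0' : orient x y i j p = 0 := by
    rw [← h0]; simp only [orient]; ring
  rcases hij with hij | ⟨-, ⟨hl, h⟩ | ⟨hl, h⟩⟩
  · exact (hij.ne heq).elim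
  · exact ⟨hiff, fun _ => ⟨h0', Or.inr ⟨hp j hj, h⟩⟩, fun hl' => (hl' (hiff.1 hl)).elim⟩
  · exact ⟨hiff, fun hl' => (hl (hiff.2 hl')).elim, fun _ => ⟨h0, Or.inl ⟨hp i hi, h⟩⟩⟩

end Slope

/-- Sorting by slope. -/
theorem exists_perm_boundaryLT {m : ℕ} {x y : Fin (m + 1) → ℝ} (hinj : Function.Injective x) :
    ∃ σ : Equiv.Perm (Fin (m + 1)), (∀ i, i ≠ σ 0 → x (σ 0) < x i) ∧
      ∀ i j, 0 < i → i < j → BoundaryLT x y (σ 0) (σ i) (σ j) := by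
  classical
  obtain ⟨p, hp⟩ := Finite.exists_min x
  let key : Fin (m + 1) → WithBot (ℝ ×ₗ ℝ) := fun i =>
    if i = p then ⊥ else
      ((toLex (slopeFrom x y p i, if NotLowest x y p i then -x i else x i) : ℝ ×ₗ ℝ) :
        WithBot (ℝ ×ₗ ℝ))
  have hkp : key p = ⊥ := if_pos rfl
  have hkey : ∀ i, i ≠ p → key i =
      ((toLex (slopeFrom x y p i, if NotLowest x y p i then -x i else x i) : ℝ ×ₗ ℝ) :
        WithBot (ℝ ×ₗ ℝ)) := fun i hi => if_neg hi
  have hle : ∀ i j, i ≠ p → j ≠ p → i ≠ j → key i ≤ key j → BoundaryLT x y p i j := by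
    intro i j hi hj hij h
    rw [hkey i hi, hkey j hj, WithBot.coe_le_coe, Prod.Lex.toLex_le_toLex] at h
    rcases h with h | ⟨h1, h2⟩
    · exact Or.inl h
    · have h1 : slopeFrom x y p i = slopeFrom x y p j := h1
      have hiff : NotLowest x y p i ↔ NotLowest x y p j := by rw [NotLowest, h1]; rfl
      have hx : x i ≠ x j := fun h => hij (hinj h)
      refine Or.inr ⟨h1, ?_⟩
      by_cases hl : NotLowest x y p i
      · simp only [hl, hiff.1 hl, if_true] at h2
        exact Or.inl ⟨hl, lt_of_le_of_ne (by linarith) hx.symm⟩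
      · have hl' : ¬ NotLowest x y p j := fun h => hl (hiff.2 h)
        simp only [if_neg hl, if_neg hl'] at h2
        exact Or.inr ⟨hl, lt_of_le_of_ne h2 hx⟩
  let σ := Tuple.sort key
  have hmono : Monotone (key ∘ σ) := Tuple.monotone_sort key
  have h0 : σ 0 = p := by
    by_contra h
    have h1 := hmono (Fin.zero_le (σ.symm p))
    simp only [Function.comp, Equiv.apply_symm_apply, hkp, le_bot_iff] at h1
    rw [hkey _ h] at h1
    exact WithBot.coe_ne_bot h1
  refine ⟨σ, ?_, ?_⟩
  · intro i hi
    rw [h0] at hi ⊢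
    exact lt_of_le_of_ne (hp i) fun h => hi (hinj h).symm
  · intro i j hi hij
    have hne : ∀ k : Fin (m + 1), 0 < k → σ k ≠ p := fun k hk h => by
      rw [← h0] at h
      exact hk.ne' (σ.injective h)
    rw [h0]
    exact hle _ _ (hne i hi) (hne j (hi.trans hij)) (fun h => hij.ne (σ.injective h))
      (hmono hij.le)

/-- The points labelled by `0, …, N` are in weakly convex position, and labelled counterclockwise.
The label `0` is at a corner, the label `N + 1` stands for it, too, and `last` are the labels
on the side which ends there. -/
structure IsBoundaryLabelling (N : ℕ) (x y : ℕ → ℝ) (last : ℕ → Prop) : Prop where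
  x_inj : ∀ i j, i ≤ N → j ≤ N → x i = x j → i = j
  x_end : x (N + 1) = x 0
  y_end : y (N + 1) = y 0
  orient_nonneg' : ∀ i j k, i < j → j < k → k ≤ N → 0 ≤ orient x y i j k
  liesBetween : ∀ i j k, 0 < i → i < j → j < k → k ≤ N → orient x y i j k = 0 →
    LiesBetween x y i j k
  last_iff : ∀ j k, 0 < j → j < k → k ≤ N → orient x y 0 j k = 0 → (last j ↔ last k)
  liesBetween_of_last : ∀ j k, 0 < j → j < k → k ≤ N → orient x y 0 j k = 0 → last k →
    LiesBetween x y j k 0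
  liesBetween_of_not_last : ∀ j k, 0 < j → j < k → k ≤ N → orient x y 0 j k = 0 → ¬ last k →
    LiesBetween x y 0 j k

/-- The point with a given label in `0, …, m`. Labels are read modulo `m + 1`. -/
def ofLabel {m : ℕ} (σ : Equiv.Perm (Fin (m + 1))) (k : ℕ) : Fin (m + 1) := σ (Fin.ofNat (m + 1) k)

theorem exists_isBoundaryLabelling {m : ℕ} {x y : Fin (m + 1) → ℝ} (hinj : Function.Injective x)
    (hs : ∀ i, HasSupport x y i) : ∃ (σ : Equiv.Perm (Fin (m + 1))) (last : ℕ → Prop),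
      IsBoundaryLabelling m (fun k => x (ofLabel σ k)) (fun k => y (ofLabel σ k)) last := by
  obtain ⟨σ, hp, hlt⟩ := exists_perm_boundaryLT (y := y) hinj
  have hval : ∀ k ≤ m, (Fin.ofNat (m + 1) k).val = k := fun k hk =>
    Nat.mod_eq_of_lt (by omega)
  have h0 : ofLabel σ 0 = σ 0 := rfl
  have hend : ofLabel σ (m + 1) = ofLabel σ 0 := by
    rw [ofLabel, ofLabel]
    congr 1
    apply Fin.ext
    simp [Fin.ofNat]
  have hinj' : ∀ i j, i ≤ m → j ≤ m → ofLabel σ i = ofLabel σ j → i = j := by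
    intro i j hi hj h
    have := congrArg Fin.val (σ.injective h)
    rwa [hval i hi, hval j hj] at this
  have hne : ∀ i, 0 < i → i ≤ m → ofLabel σ i ≠ σ 0 := fun i hi him h =>
    hi.ne' (hinj' i 0 him (Nat.zero_le m) h)
  have hlt' : ∀ i j, 0 < i → i < j → j ≤ m →
      BoundaryLT x y (σ 0) (ofLabel σ i) (ofLabel σ j) := by
    intro i j hi hij hj
    refine hlt _ _ ?_ ?_
    · rw [Fin.lt_def, hval i (by omega)]; exact hi
    · rw [Fin.lt_def, hval i (by omega), hval j hj]; exact hij
  refine ⟨σ, fun k => NotLowest x y (σ 0) (ofLabel σ k), ?_, ?_, ?_, ?_, ?_, ?_, ?_, ?_⟩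
  · exact fun i j hi hj h => hinj' i j hi hj (hinj h)
  · simp only [hend]
  · simp only [hend]
  · intro i j k hij hjk hk
    rcases Nat.eq_zero_or_pos i with rfl | hi
    · exact (orient_nonneg_of_boundaryLT (hp _ (hne j hij (by omega)))
        (hp _ (hne k (by omega) hk)) (hlt' j k hij hjk hk) :
          0 ≤ orient x y (σ 0) (ofLabel σ j) (ofLabel σ k))
    · exact (orient_of_boundaryLT hinj hp hs (hne i hi (by omega)) (hne j (by omega) (by omega))
        (hne k (by omega) hk) (hlt' i j hi hij (by omega)) (hlt' j k (by omega) hjk hk)).1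
  · intro i j k hi hij hjk hk
    exact (orient_of_boundaryLT hinj hp hs (hne i hi (by omega)) (hne j (by omega) (by omega))
      (hne k (by omega) hk) (hlt' i j hi hij (by omega)) (hlt' j k (by omega) hjk hk)).2
  · exact fun j k hj hjk hk h => (liesBetween_of_boundaryLT hp (hne j hj (by omega))
      (hne k (by omega) hk) (hlt' j k hj hjk hk) h).1
  · exact fun j k hj hjk hk h => (liesBetween_of_boundaryLT hp (hne j hj (by omega))
      (hne k (by omega) hk) (hlt' j k hj hjk hk) h).2.1
  · exact fun j k hj hjk hk h => (liesBetween_of_boundaryLT hp (hne j hj (by omega))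
      (hne k (by omega) hk) (hlt' j k hj hjk hk) h).2.2

end Labelling

/-! ### Flat labels -/

section Flat

theorem LiesBetween.trans_right {ι : Type*} {x y : ι → ℝ} {i j k l : ι}
    (h : LiesBetween x y i j k) (h' : LiesBetween x y j k l) : LiesBetween x y i k l := by
  obtain ⟨h0, h1⟩ := h
  obtain ⟨h0', h1'⟩ := h'
  have hne : x k - x j ≠ 0 := by
    rcases h1 with h | h
    · exact (sub_pos.2 h.2).ne'
    · exact (sub_neg.2 h.1).ne
  have e : (x k - x j) * orient x y i k l =
      (x k - x i) * orient x y j k l + (x l - x k) * orient x y i j k := by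
    simp only [orient]; ring
  rw [h0, h0', mul_zero, mul_zero, add_zero] at e
  refine ⟨(mul_eq_zero.1 e).resolve_left hne, ?_⟩
  rcases h1 with h | h <;> rcases h1' with h' | h'
  · left; constructor <;> linarith
  · linarith
  · linarith
  · right; constructor <;> linarith

theorem LiesBetween.symm {ι : Type*} {x y : ι → ℝ} {i j k : ι} (h : LiesBetween x y i j k) :
    LiesBetween x y k j i := by
  refine ⟨?_, h.2.symm⟩
  have := h.1
  simp only [orient] at this ⊢
  linear_combination -this

theorem LiesBetween.trans_left {ι : Type*} {x y : ι → ℝ} {i j k l : ι}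
    (h : LiesBetween x y i j k) (h' : LiesBetween x y j k l) : LiesBetween x y i j l :=
  (h'.symm.trans_right h.symm).symm

/-- The label `b` lies between the two labels next to it. -/
def IsFlat (x y : ℕ → ℝ) (b : ℕ) : Prop := LiesBetween x y (b - 1) b (b + 1)

/-- A run of flat labels is on a line, in this order. -/
theorem liesBetween_of_isFlat {x y : ℕ → ℝ} {a b c : ℕ} (hab : a < b) (hbc : b < c)
    (h : ∀ z, a < z → z < c → IsFlat x y z) : LiesBetween x y a b c := by
  have hstep : ∀ a, (∀ z, a < z → z < c → IsFlat x y z) → ∀ k, a < k → k < c →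
      LiesBetween x y a k (k + 1) := by
    intro a h k hak
    induction k, hak using Nat.le_induction with
    | base => exact fun hc => h (a + 1) (by omega) hc
    | succ k hak ih =>
      exact fun hc => (ih (by omega)).trans_right (h (k + 1) (by omega) hc)
  have key : ∀ d, b < d → d ≤ c → LiesBetween x y a b d := by
    intro d hbd
    induction d, hbd using Nat.le_induction with
    | base => exact fun hc => hstep a h b hab hc
    | succ d hbd ih =>
      exact fun hc => (ih (by omega)).trans_left
        (hstep b (fun z h1 h2 => h z (by omega) h2) d hbd (by omega))
  exact key c hbc le_rfl

theorem LiesBetween.not_rotate {ι : Type*} {x y : ι → ℝ} {i j k : ι} (h : LiesBetween x y i j k) :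
    ¬ LiesBetween x y j k i := by
  intro h'
  rcases h.2 with h | h <;> rcases h'.2 with h' | h' <;> linarith

variable {N : ℕ} {x y : ℕ → ℝ} {last : ℕ → Prop}

theorem IsBoundaryLabelling.orient_end (h : IsBoundaryLabelling N x y last) (i j : ℕ) :
    orient x y i j (N + 1) = orient x y 0 i j := by
  simp only [orient, h.x_end, h.y_end]; ring

theorem IsBoundaryLabelling.liesBetween_end (h : IsBoundaryLabelling N x y last) {i j : ℕ} :
    LiesBetween x y i j (N + 1) ↔ LiesBetween x y i j 0 := by
  simp only [LiesBetween, orient, h.x_end, h.y_end]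

theorem IsBoundaryLabelling.orient_nonneg (h : IsBoundaryLabelling N x y last) {i j k : ℕ}
    (hij : i < j) (hjk : j < k) (hk : k ≤ N + 1) : 0 ≤ orient x y i j k := by
  rcases eq_or_lt_of_le hk with rfl | hk
  · rw [h.orient_end]
    rcases Nat.eq_zero_or_pos i with rfl | hi
    · simp [orient]
    · exact h.orient_nonneg' 0 i j hi hij (by omega)
  · exact h.orient_nonneg' i j k hij hjk (by omega)

/-- A label `k` which lies between `a` and `c` is on a side of the polygon, and so are all labels
from `a` to `c`. -/
theorem IsBoundaryLabelling.isFlat (h : IsBoundaryLabelling N x y last) {a k c : ℕ} (hak : a < k)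
    (hkc : k < c) (hc : c ≤ N + 1) (hb : LiesBetween x y a k c) {z : ℕ} (haz : a < z)
    (hzc : z < c) : IsFlat x y z := by
  obtain ⟨h0, hx⟩ := hb
  have hac : x c - x a ≠ 0 := by
    rcases hx with hx | hx
    · exact (sub_pos.2 (hx.1.trans hx.2)).ne'
    · exact (sub_neg.2 (hx.1.trans hx.2)).ne
  have hac' : 0 < (x c - x a) ^ 2 := by positivity
  have hline : ∀ z, a ≤ z → z ≤ c → orient x y a c z = 0 := by
    intro z haz hzc
    rcases eq_or_lt_of_le haz with rfl | haz
    · simp [orient]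
    rcases eq_or_lt_of_le hzc with rfl | hzc
    · simp only [orient]; ring
    have h1 : orient x y a c z ≤ 0 := by
      have := h.orient_nonneg haz hzc hc
      have e : orient x y a c z = -orient x y a z c := by simp only [orient]; ring
      linarith
    refine le_antisymm h1 ?_
    rcases lt_trichotomy z k with hzk | rfl | hzk
    · have h2 := h.orient_nonneg hzk hkc hc
      have e : (x c - x a) * orient x y z k c = (x c - x k) * orient x y a c z +
          (x c - x z) * orient x y a k c := by simp only [orient]; ring
      rw [h0, mul_zero, add_zero] at e
      have hpos : 0 < (x c - x k) * (x c - x a) := by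
        rcases hx with hx | hx
        · exact mul_pos (by linarith) (by linarith)
        · exact mul_pos_of_neg_of_neg (by linarith) (by linarith)
      have e' : (x c - x a) ^ 2 * orient x y z k c =
          (x c - x k) * (x c - x a) * orient x y a c z := by linear_combination (x c - x a) * e
      have h3 := mul_nonneg hac'.le h2
      rw [e'] at h3
      exact nonneg_of_mul_nonneg_right h3 hpos
    · have e : orient x y a c z = -orient x y a z c := by simp only [orient]; ring
      rw [e, h0, neg_zero]
    · have h2 := h.orient_nonneg hak hzk (by omega)
      have e : (x c - x a) * orient x y a k z = (x k - x a) * orient x y a c z +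
          (x z - x a) * orient x y a k c := by simp only [orient]; ring
      rw [h0, mul_zero, add_zero] at e
      have hpos : 0 < (x k - x a) * (x c - x a) := by
        rcases hx with hx | hx
        · exact mul_pos (by linarith) (by linarith)
        · exact mul_pos_of_neg_of_neg (by linarith) (by linarith)
      have e' : (x c - x a) ^ 2 * orient x y a k z =
          (x k - x a) * (x c - x a) * orient x y a c z := by linear_combination (x c - x a) * e
      have h3 := mul_nonneg hac'.le h2
      rw [e'] at h3
      exact nonneg_of_mul_nonneg_right h3 hpos
  have hcol : ∀ i j l, a ≤ i → i ≤ c → a ≤ j → j ≤ c → a ≤ l → l ≤ c → orient x y i j l = 0 := by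
    intro i j l hi hi' hj hj' hl hl'
    have e : (x c - x a) * orient x y i j l =
        (x j - x i) * (orient x y a c l - orient x y a c i) -
          (x l - x i) * (orient x y a c j - orient x y a c i) := by
      simp only [orient]; ring
    rw [hline i hi hi', hline j hj hj', hline l hl hl'] at e
    simp only [sub_self, mul_zero] at e
    exact (mul_eq_zero.1 e).resolve_left hac
  have hz := hcol (z - 1) z (z + 1) (by omega) (by omega) haz.le hzc.le (by omega) (by omega)
  have hnot : ¬ (a = 0 ∧ c = N + 1) := by
    rintro ⟨rfl, rfl⟩
    exact hac (by rw [h.x_end, sub_self])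
  rcases Nat.lt_or_ge N (z + 1) with hzN | hzN
  · -- The label `c` is the corner `0`, so the labels are on the last side.
    obtain rfl : z = N := by omega
    obtain rfl : c = z + 1 := by omega
    have ha : 0 < a := by omega
    have hk : last k := by
      by_contra hk
      have h1 := h.liesBetween_of_not_last a k ha hak (by omega)
        (by rw [← h.orient_end]; exact h0) hk
      exact h1.not_rotate (h.liesBetween_end.1 ⟨h0, hx⟩)
    have hN : last z := by
      rcases eq_or_lt_of_le (by omega : k ≤ z) with rfl | hkz
      · exact hk
      · refine (h.last_iff k z (by omega) hkz le_rfl ?_).1 hk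
        rw [← h.orient_end]
        exact hcol _ _ _ (by omega) (by omega) (by omega) (by omega) (by omega) (by omega)
    have h1 := h.liesBetween_of_last (z - 1) z (by omega) (by omega) le_rfl
      (by rw [← h.orient_end]; exact hz) hN
    exact h.liesBetween_end.2 h1
  rcases Nat.eq_zero_or_pos (z - 1) with hz1 | hz1
  · -- The label `a` is the corner `0`, so the labels are on the first side.
    obtain rfl : a = 0 := by omega
    obtain rfl : z = 1 := by omega
    have hlc : ¬ last c := by
      intro hlc
      have h1 := h.liesBetween_of_last k c hak hkc (by omega) h0 hlc
      exact (show LiesBetween x y 0 k c from ⟨h0, hx⟩).not_rotate h1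
    have hl2 : ¬ last 2 := by
      rcases eq_or_lt_of_le (by omega : 2 ≤ c) with rfl | h2c
      · exact hlc
      · refine fun hl => hlc ((h.last_iff 2 c (by omega) h2c (by omega) ?_).1 hl)
        exact hcol _ _ _ (by omega) (by omega) (by omega) (by omega) (by omega) (by omega)
    exact h.liesBetween_of_not_last 1 2 (by omega) (by omega) (by omega) hz hl2
  · exact h.liesBetween (z - 1) z (z + 1) hz1 (by omega) (by omega) hzN hz

/-- If the label `N` is flat, then not all other labels are: they would form a line from `0`
to itself. -/
theorem IsBoundaryLabelling.exists_not_isFlat (h : IsBoundaryLabelling N x y last)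
    (hN : IsFlat x y N) : ∃ c, 0 < c ∧ c < N ∧ ¬ IsFlat x y c := by
  by_contra! hcon
  rcases Nat.eq_zero_or_pos N with rfl | hpos
  · rcases hN.2 with h | h
    · exact lt_irrefl _ h.1
    · exact lt_irrefl _ h.2
  · have h1 : LiesBetween x y 0 N (N + 1) := by
      refine liesBetween_of_isFlat hpos (Nat.lt_succ_self N) fun z h0 hz => ?_
      rcases eq_or_lt_of_le (Nat.le_of_lt_succ hz) with rfl | hz
      · exact hN
      · exact hcon z h0 hz
    rcases h1.2 with h1 | h1 <;> rw [h.x_end] at h1 <;> exact lt_asymm h1.1 h1.2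

/-- If a label lies between two others, then these are on the same side of the polygon. One of them
may be the corner `0`, read as the label `N + 1`. -/
theorem IsBoundaryLabelling.exists_side (h : IsBoundaryLabelling N x y last) {a k c : ℕ}
    (ha : a ≤ N) (hk : k ≤ N) (hc : c ≤ N) (hb : LiesBetween x y a k c) :
    ∃ u v, u < k ∧ k < v ∧ v ≤ N + 1 ∧ (u = a ∨ u = c) ∧
      (v = a ∨ v = c ∨ (v = N + 1 ∧ (a = 0 ∨ c = 0))) ∧
      ∀ z, u < z → z < v → IsFlat x y z := by
  wlog hac : a < c generalizing a c
  · have hne : a ≠ c := by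
      rintro rfl
      rcases hb.2 with h | h <;> exact lt_asymm h.1 h.2
    obtain ⟨u, v, h1, h2, h3, h4, h5, h6⟩ := this hc ha hb.symm (by omega)
    exact ⟨u, v, h1, h2, h3, h4.symm, by tauto, h6⟩
  have hka : k ≠ a := by
    rintro rfl
    rcases hb.2 with h | h
    · exact lt_irrefl _ h.1
    · exact lt_irrefl _ h.2
  have hkc : k ≠ c := by
    rintro rfl
    rcases hb.2 with h | h
    · exact lt_irrefl _ h.2
    · exact lt_irrefl _ h.1
  rcases lt_or_gt_of_ne hka with hka | hka
  · exfalso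
    have h0 : orient x y k a c = 0 := by
      have := hb.1
      simp only [orient] at this ⊢
      linear_combination -this
    rcases Nat.eq_zero_or_pos k with rfl | hk0
    · by_cases hl : last c
      · exact hb.not_rotate (h.liesBetween_of_last a c hka hac hc h0 hl).symm
      · exact (h.liesBetween_of_not_last a c hka hac hc h0 hl).symm.not_rotate hb
    · exact (h.liesBetween k a c hk0 hka hac hc h0).symm.not_rotate hb
  rcases lt_or_gt_of_ne hkc with hkc | hkc
  · exact ⟨a, c, hka, hkc, by omega, Or.inl rfl, Or.inr (Or.inl rfl), fun z hz hz' =>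
      h.isFlat hka hkc (by omega) hb hz hz'⟩
  · have h0 : orient x y a c k = 0 := by
      have := hb.1
      simp only [orient] at this ⊢
      linear_combination -this
    rcases Nat.eq_zero_or_pos a with rfl | ha0
    · by_cases hl : last k
      · have h1 := h.liesBetween_end.2 (h.liesBetween_of_last c k hac hkc hk h0 hl)
        exact ⟨c, N + 1, hkc, by omega, le_rfl, Or.inr rfl, Or.inr (Or.inr ⟨rfl, Or.inl rfl⟩),
          fun z hz hz' => h.isFlat hkc (by omega) le_rfl h1 hz hz'⟩
      · exact ((h.liesBetween_of_not_last c k hac hkc hk h0 hl).not_rotate hb.symm).elim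
    · exact ((h.liesBetween a c k ha0 hac hkc hk h0).not_rotate hb.symm).elim

end Flat

/-! ### Coordinates for hull configurations -/

section Coordinates

/-- A linear coordinate on the plane. For generic `t`, it is injective on a given finite set. -/
def shear (t : ℝ) (w : ℂ) : ℝ := w.re + t * w.im

theorem exists_shear_injective {ι : Type*} [Finite ι] {z : ι → ℂ} (hz : Function.Injective z) :
    ∃ t, Function.Injective fun i => shear t (z i) := by
  obtain ⟨t, ht⟩ := (Set.finite_range fun p : ι × ι =>
    -((z p.1).re - (z p.2).re) / ((z p.1).im - (z p.2).im)).exists_notMem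
  refine ⟨t, fun i j hij => ?_⟩
  by_contra hne
  simp only [shear] at hij
  by_cases him : (z i).im = (z j).im
  · refine hne (hz (Complex.ext ?_ him))
    rw [him] at hij
    linarith
  · refine ht ⟨(i, j), ?_⟩
    change -((z i).re - (z j).re) / ((z i).im - (z j).im) = t
    rw [div_eq_iff (sub_ne_zero.2 him)]
    linarith

variable {ι : Type*} {t : ℝ} {z : ι → ℂ}

theorem LiesBetween.mem_openSegment {i j k : ι}
    (h : LiesBetween (fun i => shear t (z i)) (fun i => (z i).im) i j k) :
    z j ∈ openSegment ℝ (z i) (z k) := by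
  obtain ⟨h0, h1⟩ := h
  have hne : shear t (z k) - shear t (z i) ≠ 0 := by
    rcases h1 with h | h
    · exact (sub_pos.2 (h.1.trans h.2)).ne'
    · exact (sub_neg.2 (h.1.trans h.2)).ne
  simp only [orient] at h0
  rw [openSegment_eq_image']
  refine ⟨(shear t (z j) - shear t (z i)) / (shear t (z k) - shear t (z i)), ?_, ?_⟩
  · rcases h1 with ⟨h, h'⟩ | ⟨h, h'⟩
    · exact ⟨div_pos (sub_pos.2 h) (sub_pos.2 (h.trans h')),
        (div_lt_one (sub_pos.2 (h.trans h'))).2 (by linarith)⟩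
    · exact ⟨div_pos_of_neg_of_neg (sub_neg.2 h') (sub_neg.2 (h.trans h')),
        (div_lt_one_of_neg (sub_neg.2 (h.trans h'))).2 (by linarith)⟩
  · have him : (z i).im + (shear t (z j) - shear t (z i)) / (shear t (z k) - shear t (z i)) *
        ((z k).im - (z i).im) = (z j).im := by
      field_simp
      linear_combination h0
    have hre : (z i).re + (shear t (z j) - shear t (z i)) / (shear t (z k) - shear t (z i)) *
        ((z k).re - (z i).re) = (z j).re := by
      have e1 : (shear t (z j) - shear t (z i)) / (shear t (z k) - shear t (z i)) *
        (shear t (z k) - shear t (z i)) = shear t (z j) - shear t (z i) := div_mul_cancel₀ _ hne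
      generalize (shear t (z j) - shear t (z i)) / (shear t (z k) - shear t (z i)) = r at e1 him
      simp only [shear] at e1
      linear_combination e1 - t * him
    generalize (shear t (z j) - shear t (z i)) / (shear t (z k) - shear t (z i)) = r at hre him
    apply Complex.ext
    · simpa using hre
    · simpa using him

/-- The diagonals of a convex quadrilateral meet. -/
theorem exists_mem_segment_inter {i j k l : ι}
    (hA : 0 ≤ orient (fun i => shear t (z i)) (fun i => (z i).im) i j k)
    (hB : 0 ≤ orient (fun i => shear t (z i)) (fun i => (z i).im) i j l)
    (hC : 0 ≤ orient (fun i => shear t (z i)) (fun i => (z i).im) i k l)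
    (hD : 0 ≤ orient (fun i => shear t (z i)) (fun i => (z i).im) j k l)
    (hpos : orient (fun i => shear t (z i)) (fun i => (z i).im) i j k +
      orient (fun i => shear t (z i)) (fun i => (z i).im) i k l ≠ 0) :
    (segment ℝ (z i) (z k) ∩ segment ℝ (z j) (z l)).Nonempty := by
  have hsum : orient (fun i => shear t (z i)) (fun i => (z i).im) i j l +
      orient (fun i => shear t (z i)) (fun i => (z i).im) j k l =
      orient (fun i => shear t (z i)) (fun i => (z i).im) i j k +
      orient (fun i => shear t (z i)) (fun i => (z i).im) i k l := by
    simp only [orient]; ring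
  have him : orient (fun i => shear t (z i)) (fun i => (z i).im) i k l * (z j).im +
      orient (fun i => shear t (z i)) (fun i => (z i).im) i j k * (z l).im =
      orient (fun i => shear t (z i)) (fun i => (z i).im) j k l * (z i).im +
      orient (fun i => shear t (z i)) (fun i => (z i).im) i j l * (z k).im := by
    simp only [orient]; ring
  have hre : orient (fun i => shear t (z i)) (fun i => (z i).im) i k l * (z j).re +
      orient (fun i => shear t (z i)) (fun i => (z i).im) i j k * (z l).re =
      orient (fun i => shear t (z i)) (fun i => (z i).im) j k l * (z i).re +
      orient (fun i => shear t (z i)) (fun i => (z i).im) i j l * (z k).re := by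
    simp only [orient, shear]; ring
  set A := orient (fun i => shear t (z i)) (fun i => (z i).im) i j k
  set B := orient (fun i => shear t (z i)) (fun i => (z i).im) i j l
  set C := orient (fun i => shear t (z i)) (fun i => (z i).im) i k l
  set D := orient (fun i => shear t (z i)) (fun i => (z i).im) j k l
  have hS : 0 ≤ A + C := add_nonneg hA hC
  refine ⟨(D / (A + C)) • z i + (B / (A + C)) • z k, ⟨_, _, div_nonneg hD hS, div_nonneg hB hS, ?_,
    rfl⟩, ⟨_, _, div_nonneg hC hS, div_nonneg hA hS, ?_, ?_⟩⟩
  · rw [← add_div, add_comm, hsum, div_self hpos]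
  · rw [← add_div, add_comm, div_self hpos]
  · apply Complex.ext
    · simp only [Complex.add_re, Complex.real_smul, Complex.re_ofReal_mul]
      field_simp
      linear_combination hre
    · simp only [Complex.add_im, Complex.real_smul, Complex.im_ofReal_mul]
      field_simp
      linear_combination him

/-- A point with a supporting line which is in the convex hull of others is between two of them. -/
theorem exists_liesBetween {T : Set ι} {k : ι} (hinj : Function.Injective fun i => shear t (z i))
    (hs : HasSupport (fun i => shear t (z i)) (fun i => (z i).im) k)
    (hk : z k ∈ convexHull ℝ (z '' T)) (hkT : k ∉ T) :
    ∃ a ∈ T, ∃ c ∈ T, LiesBetween (fun i => shear t (z i)) (fun i => (z i).im) a k c := by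
  obtain ⟨α, β, hne, hs⟩ := hs
  obtain ⟨κ, _, w, f, hw0, hw1, hf, hsum⟩ := mem_convexHull_iff_exists_fintype.1 hk
  choose g hg hgf using hf
  have hlin : ∀ a b : ℝ, ∑ i, w i * (a * (shear t (z (g i)) - shear t (z k)) +
      b * ((z (g i)).im - (z k).im)) = 0 := by
    intro a b
    have him : ∑ i, w i * (z (g i)).im = (z k).im := by
      rw [← hsum, Complex.im_sum]
      exact Finset.sum_congr rfl fun i _ => by rw [← hgf i]; simp
    have hre : ∑ i, w i * (z (g i)).re = (z k).re := by
      rw [← hsum, Complex.re_sum]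
      exact Finset.sum_congr rfl fun i _ => by rw [← hgf i]; simp
    have e : ∀ i, w i * (a * (shear t (z (g i)) - shear t (z k)) +
        b * ((z (g i)).im - (z k).im)) = a * (w i * (z (g i)).re) +
        (a * t + b) * (w i * (z (g i)).im) - (a * shear t (z k) + b * (z k).im) * w i := by
      intro i; simp only [shear]; ring
    simp only [e]
    rw [Finset.sum_sub_distrib, Finset.sum_add_distrib, ← Finset.mul_sum, ← Finset.mul_sum,
      ← Finset.mul_sum, him, hre, hw1]
    simp only [shear]
    ring
  have hzero : ∀ i, w i ≠ 0 → α * (shear t (z (g i)) - shear t (z k)) +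
      β * ((z (g i)).im - (z k).im) = 0 := by
    intro i hi
    have := (Finset.sum_eq_zero_iff_of_nonpos (fun i _ =>
      mul_nonpos_of_nonneg_of_nonpos (hw0 i) (hs (g i)))).1 (hlin α β) i (Finset.mem_univ i)
    exact (mul_eq_zero.1 this).resolve_left hi
  have hgk : ∀ i, shear t (z (g i)) ≠ shear t (z k) := fun i h => hkT (hinj h ▸ hg i)
  have hside : ∀ ε : ℝ, ε ≠ 0 → ∃ i, w i ≠ 0 ∧ 0 < ε * (shear t (z (g i)) - shear t (z k)) := by
    intro ε hε
    by_contra! hcon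
    have hle : ∀ i, w i * (ε * (shear t (z (g i)) - shear t (z k)) +
        0 * ((z (g i)).im - (z k).im)) ≤ 0 := by
      intro i
      rw [zero_mul, add_zero]
      by_cases hi : w i = 0
      · rw [hi, zero_mul]
      · exact mul_nonpos_of_nonneg_of_nonpos (hw0 i) (hcon i hi)
    have hw : ∀ i, w i = 0 := by
      intro i
      have := (Finset.sum_eq_zero_iff_of_nonpos (fun i _ => hle i)).1 (hlin ε 0) i
        (Finset.mem_univ i)
      rw [zero_mul, add_zero] at this
      exact (mul_eq_zero.1 this).resolve_right (mul_ne_zero hε (sub_ne_zero.2 (hgk i)))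
    simp [hw] at hw1
  obtain ⟨i, hi, hi'⟩ := hside (-1) (by norm_num)
  obtain ⟨j, hj, hj'⟩ := hside 1 one_ne_zero
  refine ⟨g i, hg i, g j, hg j, ?_, Or.inl ⟨by linarith, by linarith⟩⟩
  by_contra hdet
  have h := eq_zero_of_det_ne_zero (α := α) (β := β)
    (u₁ := shear t (z (g i)) - shear t (z k)) (v₁ := (z (g i)).im - (z k).im)
    (u₂ := shear t (z (g j)) - shear t (z k)) (v₂ := (z (g j)).im - (z k).im) ?_
    (hzero i hi) (hzero j hj)
  · exact hne.elim (fun hα => hα h.1) fun hβ => hβ h.2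
  · intro h0
    apply hdet
    simp only [orient]
    linear_combination -h0

end Coordinates

namespace Conf

variable {n : ℕ} {P : Conf n}

/-- A hull configuration has a supporting line at each of its points. -/
theorem IsHull.hasSupport (hP : P.IsHull) (t : ℝ) (i : Fin n) :
    HasSupport (fun i => shear t (P.1 i)) (fun i => (P.1 i).im) i := by
  by_cases hcol : Collinear ℝ (Set.range P.1)
  · obtain ⟨v, hv⟩ := (collinear_iff_of_mem (Set.mem_range_self i)).1 hcol
    by_cases hv0 : v = 0
    · refine ⟨1, 0, Or.inl one_ne_zero, fun k => ?_⟩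
      obtain ⟨r, hr⟩ := hv _ (Set.mem_range_self k)
      rw [hv0, smul_zero, zero_vadd] at hr
      simp [hr]
    · refine ⟨v.im, -shear t v, ?_, fun k => ?_⟩
      · by_contra! hcon
        refine hv0 (Complex.ext ?_ hcon.1)
        have := hcon.2
        simp only [shear, hcon.1] at this
        simpa using this
      · obtain ⟨r, hr⟩ := hv _ (Set.mem_range_self k)
        simp only [hr, vadd_eq_add, shear, Complex.add_re, Complex.add_im, Complex.real_smul,
          Complex.re_ofReal_mul, Complex.im_ofReal_mul]
        apply le_of_eq
        ring
  · have hint : (interior (convexHull ℝ (Set.range P.1))).Nonempty := by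
      rw [interior_convexHull_nonempty_iff_affineSpan_eq_top,
        AffineSubspace.affineSpan_eq_top_iff_vectorSpan_eq_top_of_nonempty ℝ ℂ ℂ
          (Set.range_nonempty_iff_nonempty.2 ⟨i⟩)]
      rw [collinear_iff_finrank_le_one] at hcol
      refine Submodule.eq_top_of_finrank_eq (le_antisymm (Submodule.finrank_le _) ?_)
      rw [Complex.finrank_real_complex]
      omega
    obtain ⟨f, hf, hle⟩ := geometric_hahn_banach_of_nonempty_interior_point
      (convex_convexHull ℝ _) (hP.resolve_left hcol i) hint
    have hfz : ∀ w : ℂ, f w = w.re * f 1 + w.im * f Complex.I := by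
      intro w
      have : w = w.re • (1 : ℂ) + w.im • Complex.I := by
        apply Complex.ext <;> simp
      conv_lhs => rw [this]
      rw [map_add, map_smul, map_smul, smul_eq_mul, smul_eq_mul]
    refine ⟨f 1, f Complex.I - t * f 1, ?_, fun k => ?_⟩
    · by_contra! hcon
      refine hf (ContinuousLinearMap.ext fun w => ?_)
      have h2 : f Complex.I = 0 := by
        have := hcon.2
        rw [hcon.1] at this
        linarith
      rw [hfz, hcon.1, h2]
      simp
    · have := hle _ (subset_convexHull ℝ _ (Set.mem_range_self k))
      rw [hfz (P.1 k), hfz (P.1 i)] at this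
      simp only [shear]
      linarith

theorem rel_of_mem_NC {r : Setoid (Fin n)} (hr : r ∈ P.NC) {i j k l : Fin n} (hik : r i k)
    (hjl : r j l) (h : (segment ℝ (P.1 i) (P.1 k) ∩ segment ℝ (P.1 j) (P.1 l)).Nonempty) :
    r i j := by
  by_contra hij
  obtain ⟨q, hq, hq'⟩ := h
  exact Set.disjoint_left.1 (disjoint_hull_of_mem_NC hr hij)
    (segment_subset_hull (A := {x | r x i}) (r.refl i) (r.symm hik) hq)
    (segment_subset_hull (A := {x | r x j}) (r.refl j) (r.symm hjl) hq')

end Conf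

/-! ### Walks along a side of the polygon -/

section Walks

variable {V : Type*} {τ : SimpleGraph V}

theorem mem_support_trans [DecidableEq V] (hτ : τ.Connected) {α β γ δ : V} (hne : β ≠ δ)
    (h₁ : ∀ w : τ.Walk α δ, β ∈ w.support) (h₂ : ∀ w : τ.Walk β γ, δ ∈ w.support)
    (w : τ.Walk α γ) : β ∈ w.support := by
  by_contra hβ
  have hδ : δ ∉ w.support := fun hδ =>
    hβ (w.support_takeUntil_subset_support hδ (h₁ (w.takeUntil δ hδ)))
  obtain ⟨p, hp⟩ := (hτ.preconnected α β).exists_isPath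
  have hδp : δ ∉ p.support := fun h =>
    SimpleGraph.Walk.endpoint_notMem_support_takeUntil hp h hne (h₁ _)
  have := h₂ (p.reverse.append w)
  rw [SimpleGraph.Walk.mem_support_append_iff, SimpleGraph.Walk.support_reverse,
    List.mem_reverse] at this
  exact this.elim hδp hδ

/-- If each vertex in a run `f u, …, f v` separates its neighbors in the run, then `f (u + 1)`
separates `f u` from `f v`. -/
theorem mem_support_of_run (hτ : τ.Connected) (f : ℕ → V) {v : ℕ} (d : ℕ) :
    ∀ u, u + d + 2 = v → (∀ b, u < b → b + 1 < v → f b ≠ f (b + 1)) →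
      (∀ b, u < b → b < v → ∀ w : τ.Walk (f (b - 1)) (f (b + 1)), f b ∈ w.support) →
      ∀ w : τ.Walk (f u) (f v), f (u + 1) ∈ w.support := by
  classical
  induction d with
  | zero =>
    rintro u rfl _ h w
    exact h (u + 1) (by omega) (by omega) w
  | succ d ih =>
    intro u hu hne h w
    exact mem_support_trans hτ (hne (u + 1) (by omega) (by omega))
      (h (u + 1) (by omega) (by omega))
      (ih (u + 1) (by omega) (fun b h1 h2 => hne b (by omega) h2)
        (fun b h1 h2 => h b (by omega) h2)) w

theorem Separates.comap {W : Type*} {G : SimpleGraph W} {f : V → W} (hf : Function.Injective f)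
    {x u v : V} (h : Separates G (f x) (f u) (f v)) : Separates (G.comap f) x u v := by
  obtain ⟨U, h1, h2, h3⟩ := h
  exact ⟨f ⁻¹' U, h1.imp_left fun h => hf h, h2.imp_left fun h => hf h,
    fun y z hyz hy hz hyU => h3 _ _ hyz (fun h => hy (hf h)) (fun h => hz (hf h)) hyU⟩

end Walks

/-! ### Transferring trees from labels to points -/

section Transfer

variable {m : ℕ} (σ : Equiv.Perm (Fin (m + 1)))

/-- The label in `0, …, m` of a point. -/
def label (i : Fin (m + 1)) : ℕ := (σ.symm i).val

theorem label_le (i : Fin (m + 1)) : label σ i ≤ m := by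
  have := (σ.symm i).isLt
  rw [label]
  omega

theorem ofLabel_label (i : Fin (m + 1)) : ofLabel σ (label σ i) = i := by
  simp [ofLabel, label]

theorem label_ofLabel {k : ℕ} (hk : k ≤ m) : label σ (ofLabel σ k) = k := by
  simp only [ofLabel, label, Equiv.symm_apply_apply]
  exact Nat.mod_eq_of_lt (by omega)

theorem label_injective : Function.Injective (label σ) :=
  Function.LeftInverse.injective (ofLabel_label σ)

theorem ofLabel_end : ofLabel σ (m + 1) = ofLabel σ 0 := by
  rw [ofLabel, ofLabel]
  congr 1
  apply Fin.ext
  simp [Fin.ofNat]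

variable {σ}

theorem reachable_comap_label {G : SimpleGraph ℕ} (hG : ∀ i j, G.Adj i j → i ≤ m)
    {i j : Fin (m + 1)} (h : G.Reachable (label σ i) (label σ j)) :
    (G.comap (label σ)).Reachable i j := by
  let φ : G →g G.comap (label σ) :=
    { toFun := ofLabel σ
      map_rel' := fun {a b} hab => by
        rw [SimpleGraph.comap_adj, label_ofLabel σ (hG a b hab), label_ofLabel σ (hG b a hab.symm)]
        exact hab }
  have := h.map φ
  rwa [show φ (label σ i) = i from ofLabel_label σ i,
    show φ (label σ j) = j from ofLabel_label σ j] at this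

variable {R : Setoid ℕ} {G : SimpleGraph ℕ}

theorem IsCompatibleTree.connected_comap (hG : IsCompatibleTree R G (Set.Icc 0 m)) :
    (G.comap (label σ)).Connected where
  preconnected i j := reachable_comap_label (fun a b hab => (hG.mem a b hab).2)
    (hG.reachable _ ⟨Nat.zero_le _, label_le σ i⟩ _ ⟨Nat.zero_le _, label_le σ j⟩)

theorem IsCompatibleTree.isTree_comap (hG : IsCompatibleTree R G (Set.Icc 0 m)) :
    (G.comap (label σ)).IsTree := by
  rw [SimpleGraph.isTree_iff_connected_and_card]
  refine ⟨hG.connected_comap, le_antisymm ?_ ?_⟩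
  · have h1 : (G.comap (label σ)).edgeSet.encard ≤ G.edgeSet.encard := by
      rw [← (Sym2.map.injective (label_injective σ)).encard_image]
      refine Set.encard_le_encard ?_
      rintro _ ⟨e, he, rfl⟩
      induction e with
      | _ a b => exact he
    have h2 : (G.comap (label σ)).edgeSet.encard + 1 ≤ (Set.Icc 0 m).encard :=
      (add_le_add_left h1 1).trans hG.encard_add_one_le
    rw [← Finset.coe_Icc, Set.encard_coe_eq_coe_finsetCard, Nat.card_Icc, Nat.sub_zero,
      ← (Set.toFinite _).cast_ncard_eq] at h2
    rw [Nat.card_coe_set_eq, Nat.card_eq_fintype_card, Fintype.card_fin]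
    exact_mod_cast h2
  · exact hG.connected_comap.card_vert_le_card_edgeSet_add_one

theorem IsCompatibleTree.mem_boolOfTree_comap {r : Setoid (Fin (m + 1))}
    (hG : IsCompatibleTree (r.comap (ofLabel σ)) G (Set.Icc 0 m)) :
    r ∈ Conf.boolOfTree (G.comap (label σ)) := by
  refine ⟨withinBlocks r (G.comap (label σ)), fun i j h => h.1, le_antisymm ?_ ?_⟩
  · intro i j hij
    have h := hG.reachable_within _ ⟨Nat.zero_le _, label_le σ i⟩ _ ⟨Nat.zero_le _, label_le σ j⟩
      (by rw [Setoid.comap_rel, ofLabel_label, ofLabel_label]; exact hij)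
    refine (reachable_comap_label (G := withinBlocks _ G)
      (fun a b hab => (hG.mem a b hab.1).2) h).mono ?_
    intro a b hab
    refine ⟨hab.1, ?_⟩
    have := hab.2
    rwa [Setoid.comap_rel, ofLabel_label, ofLabel_label] at this
  · rintro i j ⟨w⟩
    induction w with
    | nil => exact r.refl _
    | cons h _ ih => exact r.trans h.2 ih

end Transfer

/-! ### Noncrossing partitions of hull configurations are in Boolean subposets -/

section Crossing

variable {ι : Type*} {t : ℝ} {z : ι → ℂ}

theorem lt_of_mem_openSegment {i j : ι} {q : ℂ} (hij : shear t (z i) ≠ shear t (z j))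
    (hq : q ∈ openSegment ℝ (z i) (z j)) :
    (shear t (z i) < shear t q ∧ shear t q < shear t (z j)) ∨
      (shear t (z j) < shear t q ∧ shear t q < shear t (z i)) := by
  obtain ⟨a, b, ha, hb, hab, rfl⟩ := hq
  have e : shear t (a • z i + b • z j) = a * shear t (z i) + b * shear t (z j) := by
    simp only [shear, Complex.add_re, Complex.add_im, Complex.real_smul, Complex.re_ofReal_mul,
      Complex.im_ofReal_mul]
    ring
  have hb' : b = 1 - a := by linarith
  rw [e, hb']
  rw [hb'] at hb
  rcases hij.lt_or_gt with h | h
  · have h1 := mul_pos ha (sub_pos.2 h)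
    have h2 := mul_pos hb (sub_pos.2 h)
    exact Or.inl ⟨by linarith, by linarith⟩
  · have h1 := mul_pos ha (sub_pos.2 h)
    have h2 := mul_pos hb (sub_pos.2 h)
    exact Or.inr ⟨by linarith, by linarith⟩

/-- Two segments which meet, such that the ends of the second one are not strictly on different
sides of the first one, are on a line. -/
theorem orient_eq_zero_of_mem_openSegment {i j k l : ι} {q : ℂ}
    (hq : q ∈ openSegment ℝ (z i) (z j)) (hq' : q ∈ openSegment ℝ (z k) (z l))
    (h : 0 ≤ orient (fun i => shear t (z i)) (fun i => (z i).im) i j k *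
      orient (fun i => shear t (z i)) (fun i => (z i).im) i j l) :
    orient (fun i => shear t (z i)) (fun i => (z i).im) i j k = 0 := by
  obtain ⟨a, b, ha, hb, hab, rfl⟩ := hq
  obtain ⟨c, d, hc, hd, hcd, he⟩ := hq'
  have hre := congrArg Complex.re he
  have him := congrArg Complex.im he
  simp only [Complex.add_re, Complex.add_im, Complex.real_smul, Complex.re_ofReal_mul,
    Complex.im_ofReal_mul] at hre him
  obtain rfl : a = 1 - b := by linarith
  obtain rfl : c = 1 - d := by linarith
  have h0 : (1 - d) * orient (fun i => shear t (z i)) (fun i => (z i).im) i j k +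
      d * orient (fun i => shear t (z i)) (fun i => (z i).im) i j l = 0 := by
    simp only [orient, shear]
    linear_combination ((z j).re - (z i).re) * him - ((z j).im - (z i).im) * hre
  generalize orient (fun i => shear t (z i)) (fun i => (z i).im) i j k = A at *
  generalize orient (fun i => shear t (z i)) (fun i => (z i).im) i j l = B at *
  have h1 : (1 - d) * A ^ 2 + d * (A * B) = 0 := by linear_combination A * h0
  have h2 : (1 - d) * A ^ 2 = 0 := by
    have := mul_nonneg hc.le (sq_nonneg A)
    have := mul_nonneg hd.le h
    linarith
  exact pow_eq_zero_iff two_ne_zero |>.1 ((mul_eq_zero.1 h2).resolve_left hc.ne')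

/-- Two overlapping segments on a line: an end of one of them is inside the other one. -/
theorem liesBetween_of_mem_openSegment {i j k l : ι} {q : ℂ}
    (hinj : Function.Injective fun i => shear t (z i)) (hij : i ≠ j) (hkl : k ≠ l) (hik : i ≠ k)
    (hil : i ≠ l) (hq : q ∈ openSegment ℝ (z i) (z j)) (hq' : q ∈ openSegment ℝ (z k) (z l))
    (h : 0 ≤ orient (fun i => shear t (z i)) (fun i => (z i).im) i j k *
      orient (fun i => shear t (z i)) (fun i => (z i).im) i j l) :
    LiesBetween (fun i => shear t (z i)) (fun i => (z i).im) i k j ∨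
      LiesBetween (fun i => shear t (z i)) (fun i => (z i).im) i l j ∨
      LiesBetween (fun i => shear t (z i)) (fun i => (z i).im) k i l := by
  have hk := orient_eq_zero_of_mem_openSegment hq hq' h
  have hl := orient_eq_zero_of_mem_openSegment hq (openSegment_symm ℝ (z k) (z l) ▸ hq')
    (mul_comm (orient (fun i => shear t (z i)) (fun i => (z i).im) i j k) _ ▸ h)
  have hx := lt_of_mem_openSegment (fun h => hij (hinj h)) hq
  have hx' := lt_of_mem_openSegment (fun h => hkl (hinj h)) hq'
  have hik' : shear t (z i) ≠ shear t (z k) := fun h => hik (hinj h)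
  have hil' : shear t (z i) ≠ shear t (z l) := fun h => hil (hinj h)
  have hij' : shear t (z j) - shear t (z i) ≠ 0 := sub_ne_zero.2 fun h => hij (hinj h).symm
  have ek : orient (fun i => shear t (z i)) (fun i => (z i).im) i k j = 0 := by
    simp only [orient] at hk ⊢
    linear_combination -hk
  have el : orient (fun i => shear t (z i)) (fun i => (z i).im) i l j = 0 := by
    simp only [orient] at hl ⊢
    linear_combination -hl
  have ei : orient (fun i => shear t (z i)) (fun i => (z i).im) k i l = 0 := by
    refine (mul_eq_zero.1 (?_ : (shear t (z j) - shear t (z i)) * _ = 0)).resolve_left hij'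
    simp only [orient] at hk hl ⊢
    linear_combination (shear t (z l) - shear t (z i)) * hk -
      (shear t (z k) - shear t (z i)) * hl
  simp only [LiesBetween, ek, el, ei, true_and]
  generalize shear t (z i) = xi at *
  generalize shear t (z j) = xj at *
  generalize shear t (z k) = xk at *
  generalize shear t (z l) = xl at *
  generalize shear t q = xq at *
  rcases hx with ⟨h1, h2⟩ | ⟨h1, h2⟩ <;> rcases hx' with ⟨h3, h4⟩ | ⟨h3, h4⟩ <;>
    rcases hik'.lt_or_gt with h5 | h5 <;> rcases hil'.lt_or_gt with h6 | h6 <;>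
    first
    | exact Or.inl (Or.inl ⟨by linarith, by linarith⟩)
    | exact Or.inl (Or.inr ⟨by linarith, by linarith⟩)
    | exact Or.inr (Or.inl (Or.inl ⟨by linarith, by linarith⟩))
    | exact Or.inr (Or.inl (Or.inr ⟨by linarith, by linarith⟩))
    | exact Or.inr (Or.inr (Or.inl ⟨by linarith, by linarith⟩))
    | exact Or.inr (Or.inr (Or.inr ⟨by linarith, by linarith⟩))

/-- The ends of an edge are not strictly on different sides of an edge with which it does not cross
in the cyclic order of the labels. -/
theorem IsBoundaryLabelling.orient_mul_nonneg {N : ℕ} {x y : ℕ → ℝ} {last : ℕ → Prop}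
    (h : IsBoundaryLabelling N x y last) {G : SimpleGraph ℕ}
    (hG : ∀ i j k l, G.Adj i j → G.Adj k l → i < k → k < j → j < l → False)
    {a b c d : ℕ} (ha : a ≤ N) (hb : b ≤ N) (hc : c ≤ N) (hd : d ≤ N) (hab : G.Adj a b)
    (hcd : G.Adj c d) (hac : a ≠ c) (had : a ≠ d) (hbc : b ≠ c) (hbd : b ≠ d) :
    0 ≤ orient x y a b c * orient x y a b d := by
  wlog hlt : a < b generalizing a b
  · have := this hb ha hab.symm hbc hbd hac had (by have := hab.ne; omega)
    have e : ∀ c, orient x y b a c = -orient x y a b c := fun c => by simp only [orient]; ring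
    rwa [e, e, neg_mul_neg] at this
  have hout : ∀ c ≤ N, c < a ∨ b < c → 0 ≤ orient x y a b c := by
    rintro c hc (hca | hbc)
    · have := h.orient_nonneg hca hlt (by omega)
      have e : orient x y a b c = orient x y c a b := by simp only [orient]; ring
      rwa [e]
    · exact h.orient_nonneg hlt hbc (by omega)
  have hin : ∀ c, a < c → c < b → orient x y a b c ≤ 0 := by
    intro c hac hcb
    have := h.orient_nonneg hac hcb (by omega)
    have e : orient x y a b c = -orient x y a c b := by simp only [orient]; ring
    rw [e]
    exact neg_nonpos.2 this
  by_cases hc' : a < c ∧ c < b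
  · by_cases hd' : a < d ∧ d < b
    · exact mul_nonneg_of_nonpos_of_nonpos (hin c hc'.1 hc'.2) (hin d hd'.1 hd'.2)
    · rcases (by omega : d < a ∨ b < d) with hd' | hd'
      · exact (hG d c a b hcd.symm hab hd' hc'.1 hc'.2).elim
      · exact (hG a b c d hab hcd hc'.1 hc'.2 hd').elim
  · by_cases hd' : a < d ∧ d < b
    · rcases (by omega : c < a ∨ b < c) with hc' | hc'
      · exact (hG c d a b hcd hab hc' hd'.1 hd'.2).elim
      · exact (hG a b d c hab hcd.symm hd'.1 hd'.2 hc').elim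
    · exact mul_nonneg (hout c hc (by omega)) (hout d hd (by omega))

end Crossing

namespace Conf

variable {m : ℕ} (P : Conf (m + 1)) (t : ℝ) (σ : Equiv.Perm (Fin (m + 1)))

/-- The first coordinate of the point with a given label. -/
abbrev labelX (k : ℕ) : ℝ := shear t (P.1 (ofLabel σ k))

/-- The second coordinate of the point with a given label. -/
abbrev labelY (k : ℕ) : ℝ := (P.1 (ofLabel σ k)).im

variable {P t σ} {last : ℕ → Prop}

/-- The blocks of a noncrossing partition do not cross in the cyclic order of the labels, and meet
each side of the polygon in an interval, so the construction of trees on labels applies. -/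
theorem exists_labelled_tree (h : IsBoundaryLabelling m (P.labelX t σ) (P.labelY σ) last)
    {r : Setoid (Fin (m + 1))} (hr : r ∈ P.NC) :
    ∃ G, IsGeodesicTree (r.comap (ofLabel σ)) (IsFlat (P.labelX t σ) (P.labelY σ)) 0 m G ∧
      (IsFlat (P.labelX t σ) (P.labelY σ) m → Separates G m (m - 1) 0) := by
  have hbetween : ∀ {a b c : ℕ}, LiesBetween (P.labelX t σ) (P.labelY σ) a b c →
      r (ofLabel σ a) (ofLabel σ c) → r (ofLabel σ a) (ofLabel σ b) := by
    intro a b c hb hac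
    have hmem := LiesBetween.mem_openSegment (z := fun k => P.1 (ofLabel σ k)) hb
    exact rel_of_mem_NC hr hac (r.refl _)
      ⟨_, openSegment_subset_segment _ _ _ hmem, left_mem_segment _ _ _⟩
  refine exists_geodesicTree ?_ ?_ (fun hL => h.exists_not_isFlat hL) ?_
  · intro i j k l hij hjk hkl hl hik hjl
    by_cases hpos : orient (P.labelX t σ) (P.labelY σ) i j k +
      orient (P.labelX t σ) (P.labelY σ) i k l = 0
    · have hA := h.orient_nonneg hij hjk (by omega)
      have hB := h.orient_nonneg hij (hjk.trans hkl) (by omega)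
      have hC := h.orient_nonneg (hij.trans hjk) hkl (by omega)
      have hD := h.orient_nonneg hjk hkl (by omega)
      have hD0 : orient (P.labelX t σ) (P.labelY σ) j k l = 0 := by
        refine le_antisymm ?_ hD
        have hsum := orient_eq_add (P.labelX t σ) (P.labelY σ) i j k l
        linarith
      have := hbetween (h.liesBetween j k l (by omega) hjk hkl hl hD0) hjl
      exact r.trans hik (r.symm this)
    · exact rel_of_mem_NC hr hik hjl (exists_mem_segment_inter (z := fun k => P.1 (ofLabel σ k))
        (h.orient_nonneg hij hjk (by omega)) (h.orient_nonneg hij (hjk.trans hkl) (by omega))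
        (h.orient_nonneg (hij.trans hjk) hkl (by omega)) (h.orient_nonneg hjk hkl (by omega)) hpos)
  · exact fun a b c hab hbc _ hF => hbetween (liesBetween_of_isFlat hab hbc hF)
  · intro hL a b ha hab hb hF h0a
    have hb' : LiesBetween (P.labelX t σ) (P.labelY σ) a b (m + 1) := by
      refine liesBetween_of_isFlat hab (by omega) fun x hax hx => ?_
      rcases eq_or_lt_of_le (Nat.le_of_lt_succ hx) with rfl | hx
      · exact hL
      · exact hF x hax hx
    have := hbetween hb' (by rw [ofLabel_end]; exact r.symm h0a)
    exact r.trans h0a this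

/-- If the convex hull of a subtree contains another point `k`, then `k` is on a side of the polygon,
strictly between two vertices of the subtree. But the path in the tree between points of a side
passes through all points between them, as flat labels separate their neighbors. -/
theorem hasConvexGeodesics_comap (h : IsBoundaryLabelling m (P.labelX t σ) (P.labelY σ) last)
    (hinj : Function.Injective fun i => shear t (P.1 i))
    (hs : ∀ i, HasSupport (fun i => shear t (P.1 i)) (fun i => (P.1 i).im) i)
    {R : Setoid ℕ} {G : SimpleGraph ℕ}
    (hG : IsGeodesicTree R (IsFlat (P.labelX t σ) (P.labelY σ)) 0 m G)
    (hG' : IsFlat (P.labelX t σ) (P.labelY σ) m → Separates G m (m - 1) 0) :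
    P.HasConvexGeodesics (G.comap (label σ)) := by
  intro T hT k hk
  by_contra hkT
  obtain ⟨a, ha, c, hc, hb⟩ := exists_liesBetween hinj (hs k) hk hkT
  have hb' : LiesBetween (P.labelX t σ) (P.labelY σ) (label σ a) (label σ k) (label σ c) := by
    simpa only [LiesBetween, orient, labelX, labelY, ofLabel_label] using hb
  have hmem : ∀ {u : ℕ}, u = label σ a ∨ u = label σ c → ofLabel σ u ∈ T.verts := by
    rintro u (rfl | rfl)
    · rwa [ofLabel_label]
    · rwa [ofLabel_label]
  obtain ⟨u, v, huk, hkv, hv, hu', hv', hF⟩ :=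
    h.exists_side (label_le σ a) (label_le σ k) (label_le σ c) hb'
  have hvT : ofLabel σ v ∈ T.verts := by
    rcases hv' with hv' | hv' | ⟨rfl, hv'⟩
    · exact hmem (Or.inl hv')
    · exact hmem (Or.inr hv')
    · rw [ofLabel_end]
      exact hmem (hv'.imp Eq.symm Eq.symm)
  -- The last vertex of the subtree before `k` on the side.
  obtain ⟨p, hup, hpk, hpT, hpT'⟩ : ∃ p, u ≤ p ∧ p < label σ k ∧ ofLabel σ p ∈ T.verts ∧
      ofLabel σ (p + 1) ∉ T.verts := by
    by_contra! hcon
    have hall : ∀ p, u ≤ p → p ≤ label σ k → ofLabel σ p ∈ T.verts := by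
      intro p hp
      induction p, hp using Nat.le_induction with
      | base => exact fun _ => hmem hu'
      | succ p hp ih => exact fun hpk => hcon p hp hpk (ih (by omega))
    have := hall _ huk.le le_rfl
    rw [ofLabel_label] at this
    exact hkT this
  have hsep : ∀ b, p < b → b < v → ∀ w : (G.comap (label σ)).Walk (ofLabel σ (b - 1))
      (ofLabel σ (b + 1)), ofLabel σ b ∈ w.support := by
    intro b hpb hbv
    have hFb := hF b (by omega) hbv
    have hsep' : Separates (G.comap (label σ)) (ofLabel σ b) (ofLabel σ (b - 1))
        (ofLabel σ (b + 1)) := by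
      apply Separates.comap (label_injective σ)
      rw [label_ofLabel σ (by omega : b ≤ m), label_ofLabel σ (by omega : b - 1 ≤ m)]
      rcases eq_or_lt_of_le (by omega : b ≤ m) with rfl | hbm
      · rw [ofLabel_end, label_ofLabel σ (Nat.zero_le _)]
        exact hG' hFb
      · rw [label_ofLabel σ (by omega : b + 1 ≤ m)]
        exact hG.separates b (by omega) hbm hFb
    exact hsep'.mem_support
  have hrun := mem_support_of_run hG.tree.connected_comap (ofLabel σ) (v := v) (v - p - 2) p
    (by omega) (fun b hb hbv heq => ?_) hsep
  · obtain ⟨w⟩ := hT.coe.preconnected ⟨_, hpT⟩ ⟨_, hvT⟩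
    have := hrun (w.map T.hom)
    obtain ⟨y, -, hy⟩ := List.mem_map.1
      ((congrArg (ofLabel σ (p + 1) ∈ ·) (SimpleGraph.Walk.support_map T.hom w)).mp this)
    exact hpT' (hy ▸ y.2)
  · have := congrArg (label σ) heq
    rw [label_ofLabel σ (by omega), label_ofLabel σ (by omega)] at this
    omega

/-- A noncrossing partition `r` of a hull configuration is in `Bool(τ)` for a noncrossing tree `τ`
with convex geodesics. -/
theorem exists_mem_boolOfTree (hP : P.IsHull) {r : Setoid (Fin (m + 1))} (hr : r ∈ P.NC) :
    ∃ τ, P.IsNoncrossingTree τ ∧ P.HasConvexGeodesics τ ∧ r ∈ boolOfTree τ := by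
  obtain ⟨t, hinj⟩ := exists_shear_injective P.2
  have hs := hP.hasSupport t
  obtain ⟨σ, last, h⟩ := exists_isBoundaryLabelling hinj hs
  obtain ⟨G, hG, hG'⟩ := exists_labelled_tree (P := P) (t := t) (σ := σ) h hr
  have hcg := hasConvexGeodesics_comap h hinj hs hG hG'
  refine ⟨G.comap (label σ), ⟨hG.tree.isTree_comap, hcg.isEmbeddedGraph ?_⟩, hcg,
    hG.tree.mem_boolOfTree_comap⟩
  intro i j k l hij hkl hik hil hjk hjl
  rw [Set.disjoint_left]
  intro q hq hq'
  have hne : ∀ {i j}, i ≠ j → label σ i ≠ label σ j := fun h h' => h (label_injective σ h')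
  have hmul := h.orient_mul_nonneg hG.tree.noncrossing (label_le σ i) (label_le σ j)
    (label_le σ k) (label_le σ l) hij hkl (hne hik) (hne hil) (hne hjk) (hne hjl)
  simp only [orient, ofLabel_label] at hmul
  rcases liesBetween_of_mem_openSegment hinj hij.ne hkl.ne hik hil hq hq' hmul with hb | hb | hb
  · exact hcg.notMem_openSegment hij k hb.mem_openSegment
  · exact hcg.notMem_openSegment hij l hb.mem_openSegment
  · exact hcg.notMem_openSegment hkl i hb.mem_openSegment

end Conf

theorem theoremB (n : ℕ) (hn : 1 ≤ n) (P : Conf n) (hP : P.IsHull) :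
    Set.BijOn Conf.boolOfTree
      {τ : SimpleGraph (Fin n) | P.IsNoncrossingTree τ ∧ P.HasConvexGeodesics τ}
      {B : Set (Setoid (Fin n)) | P.IsMaximalBoolean B} ∧
    ⋃₀ {B : Set (Setoid (Fin n)) | P.IsMaximalBoolean B} = P.NC := by
  have hmaps : ∀ τ, P.IsNoncrossingTree τ → P.HasConvexGeodesics τ →
      P.IsMaximalBoolean (Conf.boolOfTree τ) := fun τ hτ hcg =>
    ⟨Conf.boolOfTree_subset_NC hτ.2 hcg, Conf.nonempty_boolOfTree_orderIso hτ.1⟩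
  refine ⟨⟨fun τ hτ => hmaps τ hτ.1 hτ.2, ?_, ?_⟩, ?_⟩
  · intro G _ H _ h
    exact le_antisymm (Conf.le_of_boolOfTree_subset h.subset)
      (Conf.le_of_boolOfTree_subset h.superset)
  · rintro B ⟨hB, ⟨e⟩⟩
    obtain ⟨G, hG, rfl⟩ := Conf.exists_tree_of_orderIso hn e
    exact ⟨G, ⟨⟨hG, Conf.isEmbeddedGraph_of_boolOfTree_subset hB⟩,
      Conf.hasConvexGeodesics_of_boolOfTree_subset hB⟩, rfl⟩
  · refine Set.Subset.antisymm (Set.sUnion_subset fun B hB => hB.1) fun r hr => ?_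
    obtain ⟨m, rfl⟩ : ∃ m, n = m + 1 := ⟨n - 1, by omega⟩
    obtain ⟨τ, hτ, hcg, hrτ⟩ := Conf.exists_mem_boolOfTree hP hr
    exact ⟨_, hmaps τ hτ hcg, hrτ⟩
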